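/- Let $\overline\rho>0$, $f\in C^1[0,\overline\rho]$ with $f(0)=0$ and $h:=f'$; let $D,g$ be continuous on $[0,\overline\rho]$. Consider the equation $$\rho_t+f(\rho)_x=(D(\rho)\rho_x)_x+g(\rho).\qquad (E_g)$$ **Conditions.** - $(\hat{\rm D})$: $D\in C^1[0,\overline\rho]$ and $D>0$ in $(0,\overline\rho)$. - $(\tilde{\rm D})$ (on the pair $D,g$): $D\in C[0,\overline\rho]\cap C^1[0,\overline\rho)$, $D(\overline\rho)=0$, $D>0$ in $(0,\overline\rho)$, $\dot D(\overline\rho)=-\infty$, and $\lim_{\rho\to\overline\rho^-}\frac{D(\rho)g(\rho)}{\rho-\overline\rho}$ exists in $(-\infty,0]$. - $({\rm g})$: $g>0$ in $[0,\overline\rho)$ and $g(\overline\rho)=0$. - $({\rm g}_0)$: $g>0$ in $(0,\overline\rho)$, $g(0)=g(\overline\rho)=0$ and $\limsup_{\rho\to0^+}\frac{D(\rho)g(\rho)}{\rho}<+\infty$. **Profiles.** A traveling-wave profile of $(E_g)$ with speed $c\in\mathbb R$ on an open interval $I$ is a continuous, a.e. differentiable $\varphi:I\to[0,\overline\rho]$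 with $D(\varphi)\varphi'\in L^1_{\rm loc}(I)$ and $$\int_I\{(D(\varphi)\varphi'-f(\varphi)+c\varphi)\psi'-g(\varphi)\psi\}\,d\xi=0\quad\text{for all }\psi\in C_0^\infty(I).$$ It is classical in an open set $U\subseteq I$ if in $U$ it is differentiable, $D(\varphi)\varphi'$ is absolutely continuous on compact intervals, and $(D(\varphi)\varphi')'+(c-h(\varphi))\varphi'+g(\varphi)=0$ a.e. All profiles below are assumed to be classical or sharp, that is, classical in $I\setminus S$ for a finite (possibly empty) set $S\subset I$ at each point of which $\varphi$ is not differentiable and takes as value a zero of $g$. - A wavefront profile connecting $\overline\rho$ with $0$ is such a profile on $I=\mathbb R$ with $\varphi(-\infty)=\overline\rho$ and $\varphi(+\infty)=0$, where $g(\overline\rho)=g(0)=0$. - A semi-wavefront profile from $\overline\rho$ is such a profile on $I=(-\infty,\varpi)$, $\varpi\in\mathbb R$, that is (weakly) monotone, non-constant and satisfies $\varphi(\xi)\to\overline\rho$ as $\xi\to-\infty$, where $g(\overline\rho)=0$. It is maximal if it does not extend to a semi-wavefront profile from $\overline\rho$, with the same speed, on a half-line $(-\infty,\varpi')$ with $\varpi'>\varpi$.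 **Theorem (Convergence of semi-wavefront profiles to a wavefront profile).** Let $g_0\in C[0,\overline\rho]$ satisfy $({\rm g}_0)$, and let $\{g_n\}_{n\ge1}\subset C[0,\overline\rho]$ be a decreasing sequence (that is, $g_{n+1}\le g_n$ on $[0,\overline\rho]$) of functions that satisfy $({\rm g})$, with $g_n\to g_0$ uniformly on $[0,\overline\rho]$. Assume that either $D$ satisfies $(\hat{\rm D})$, or $(D,g_n)$ satisfies $(\tilde{\rm D})$ for every $n\ge0$. Let $c_0^*$ be the threshold speed for $g_0$, i.e. the infimum of the speeds of the wavefront profiles of $(E_{g_0})$ connecting $\overline\rho$ with $0$, and let $c\ge c_0^*$. Let $\varphi_0$ be a wavefront profile of $(E_{g_0})$ connecting $\overline\rho$ with $0$ and, for $n\ge1$, let $\varphi_n:(-\infty,\varpi_n)\to[0,\overline\rho]$ be a maximal semi-wavefront profile of $(E_{g_n})$ from $\overline\rho$, all of them with speed $c$, with $\varpi_n>0$ and $\varphi_n(0)=\overline\rho/2$ for every $n$ (including $n=0$ for the last equality). Let $J$ be the maximal open interval on which $0<\varphi_0<\overline\rho$. Then $\varphi_n\to\varphi_0$ in $C^1_{\rm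 loc}(J)$: $\varphi_0\in C^1(J)$ and, for every compact $K\subset J$, for all large $n$ the profile $\varphi_n$ is defined and $C^1$ in a neighborhood of $K$, and $\varphi_n\to\varphi_0$ and $\varphi_n'\to\varphi_0'$ uniformly on $K$. -/

import Mathlib

open Set Filter Topology MeasureTheory
open scoped ContDiff

namespace SemiWave

/-! The equation is `ρ_t + f(ρ)_x = (D(ρ) ρ_x)_x + g(ρ)` with unknown valued in `[0, ρbar]`.
The functions `f`, `D`, `g` are total functions on `ℝ`; only their values on `Icc 0 ρbar` matter.
A profile defined on an open interval `I` is a total function of which only the values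
on `I` matter. -/

/-- `h = f'` on `[0, ρbar]` (one-sided derivatives at the end points). -/
noncomputable def h (ρbar : ℝ) (f : ℝ → ℝ) : ℝ → ℝ := derivWithin f (Icc 0 ρbar)

/-- Condition (D̂): `D ∈ C¹[0, ρbar]` is positive in `(0, ρbar)`. -/
structure CondDhat (ρbar : ℝ) (D : ℝ → ℝ) : Prop where
  contDiffOn : ContDiffOn ℝ 1 D (Icc 0 ρbar)
  pos : ∀ ρ ∈ Ioo 0 ρbar, 0 < D ρ

/-- Condition (D̃), a joint condition on `D` and the source term `g`. -/
structure CondDtilde (ρbar : ℝ) (D g : ℝ → ℝ) : Prop where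
  continuousOn : ContinuousOn D (Icc 0 ρbar)
  contDiffOn : ContDiffOn ℝ 1 D (Ico 0 ρbar)
  eq_zero : D ρbar = 0
  pos : ∀ ρ ∈ Ioo 0 ρbar, 0 < D ρ
  /-- the left derivative of `D` at `ρbar` is `-∞` -/
  deriv_eq : Tendsto (fun ρ => (D ρ - D ρbar) / (ρ - ρbar)) (𝓝[<] ρbar) atBot
  limit : ∃ L : ℝ, L ≤ 0 ∧ Tendsto (fun ρ => D ρ * g ρ / (ρ - ρbar)) (𝓝[<] ρbar) (𝓝 L)

/-- Condition (g), for a continuous source term. -/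
structure CondG (ρbar : ℝ) (g : ℝ → ℝ) : Prop where
  continuousOn : ContinuousOn g (Icc 0 ρbar)
  pos : ∀ ρ ∈ Ico 0 ρbar, 0 < g ρ
  eq_zero : g ρbar = 0

/-- Condition (g₀) (monostability), for a continuous source term. -/
structure CondG₀ (ρbar : ℝ) (D g : ℝ → ℝ) : Prop where
  continuousOn : ContinuousOn g (Icc 0 ρbar)
  pos : ∀ ρ ∈ Ioo 0 ρbar, 0 < g ρ
  eq_zero_left : g 0 = 0
  eq_zero_right : g ρbar = 0
  limsup_lt : limsup (fun ρ => ((D ρ * g ρ / ρ : ℝ) : EReal)) (𝓝[>] 0) < ⊤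

/-- `φ` is the profile of a traveling-wave solution with speed `c`, on the open interval `I`. -/
structure IsTravelingWave (ρbar : ℝ) (f D g : ℝ → ℝ) (c : ℝ) (I : Set ℝ) (φ : ℝ → ℝ) :
    Prop where
  isOpen : IsOpen I
  ordConnected : I.OrdConnected
  mapsTo : MapsTo φ I (Icc 0 ρbar)
  continuousOn : ContinuousOn φ I
  ae_differentiableAt : ∀ᵐ ξ ∂(volume.restrict I), DifferentiableAt ℝ φ ξ
  locallyIntegrableOn : LocallyIntegrableOn (fun ξ => D (φ ξ) * deriv φ ξ) I
  weak : ∀ ψ : ℝ → ℝ, ContDiff ℝ ∞ ψ → HasCompactSupport ψ → tsupport ψ ⊆ I →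
    ∫ ξ in I, ((D (φ ξ) * deriv φ ξ - f (φ ξ) + c * φ ξ) * deriv ψ ξ - g (φ ξ) * ψ ξ) = 0

/-- `φ` is classical in the open set `U`: it is differentiable, `D(φ) φ'` is absolutely continuous
(on compact intervals) and `(D(φ) φ')' + (c - h(φ)) φ' + g(φ) = 0` a.e. -/
structure IsClassicalOn (ρbar : ℝ) (f D g : ℝ → ℝ) (c : ℝ) (U : Set ℝ) (φ : ℝ → ℝ) :
    Prop where
  differentiableAt : ∀ ξ ∈ U, DifferentiableAt ℝ φ ξ
  absolutelyContinuous : ∀ a b : ℝ, a ≤ b → Icc a b ⊆ U →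
    AbsolutelyContinuousOnInterval (fun ξ => D (φ ξ) * deriv φ ξ) a b
  equation : ∀ᵐ ξ ∂(volume.restrict U),
    HasDerivAt (fun ξ => D (φ ξ) * deriv φ ξ)
      (-((c - h ρbar f (φ ξ)) * deriv φ ξ + g (φ ξ))) ξ

/-- `φ` is classical or sharp in `I`: it is classical in `I` except at finitely many points (possibly
none), at each of which it takes a zero of `g` as its value and is not differentiable.
(A profile may be sharp at both zeros of `g`.) -/
def IsClassicalOrSharp (ρbar : ℝ) (f D g : ℝ → ℝ) (c : ℝ) (I : Set ℝ) (φ : ℝ → ℝ) : Prop :=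
  ∃ S : Set ℝ, S.Finite ∧ S ⊆ I ∧ (∀ ξ ∈ S, g (φ ξ) = 0 ∧ ¬ DifferentiableAt ℝ φ ξ) ∧
    IsClassicalOn ρbar f D g c (I \ S) φ

/-- `φ` is a (classical or sharp) profile on `(-∞, ϖ)` of a semi-wavefront solution from `ℓ`. -/
structure IsSemiWavefrontFrom (ρbar : ℝ) (f D g : ℝ → ℝ) (c ℓ ϖ : ℝ) (φ : ℝ → ℝ) : Prop where
  travelingWave : IsTravelingWave ρbar f D g c (Iio ϖ) φ
  classicalOrSharp : IsClassicalOrSharp ρbar f D g c (Iio ϖ) φ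
  mem : ℓ ∈ Icc 0 ρbar
  source_eq_zero : g ℓ = 0
  monotonic : MonotoneOn φ (Iio ϖ) ∨ AntitoneOn φ (Iio ϖ)
  nonconstant : ∃ ξ₁ ∈ Iio ϖ, ∃ ξ₂ ∈ Iio ϖ, φ ξ₁ ≠ φ ξ₂
  tendsto : Tendsto φ atBot (𝓝 ℓ)

/-- A semi-wavefront profile from `ℓ` on `(-∞, ϖ)` that is maximal: it does not extend to
a semi-wavefront profile on a larger half-line. -/
def IsMaximalSemiWavefrontFrom (ρbar : ℝ) (f D g : ℝ → ℝ) (c ℓ ϖ : ℝ) (φ : ℝ → ℝ) : Prop :=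
  IsSemiWavefrontFrom ρbar f D g c ℓ ϖ φ ∧
    ∀ ϖ' : ℝ, ϖ < ϖ' → ¬ ∃ φ' : ℝ → ℝ,
      IsSemiWavefrontFrom ρbar f D g c ℓ ϖ' φ' ∧ EqOn φ' φ (Iio ϖ)

/-- `φ` is a (classical or sharp) wavefront profile connecting `ℓm` (at `-∞`) with `ℓp` (at `+∞`). -/
structure IsWavefront (ρbar : ℝ) (f D g : ℝ → ℝ) (c ℓm ℓp : ℝ) (φ : ℝ → ℝ) : Prop where
  travelingWave : IsTravelingWave ρbar f D g c univ φ
  classicalOrSharp : IsClassicalOrSharp ρbar f D g c univ φ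
  source_left : g ℓm = 0
  source_right : g ℓp = 0
  tendsto_atBot : Tendsto φ atBot (𝓝 ℓm)
  tendsto_atTop : Tendsto φ atTop (𝓝 ℓp)

/-- The threshold speed: the infimum of the speeds of the wavefronts connecting `ρbar` with `0`
(in the extended reals, so that no convention is needed for an empty set of speeds). -/
noncomputable def thresholdSpeed (ρbar : ℝ) (f D g : ℝ → ℝ) : EReal :=
  sInf {s : EReal | ∃ c : ℝ, s = (c : EReal) ∧ ∃ φ : ℝ → ℝ, IsWavefront ρbar f D g c ρbar 0 φ}

/-- `J` is a maximal open interval on which `0 < φ < ρbar`. -/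
def IsMaximalOpenInterval (ρbar : ℝ) (φ : ℝ → ℝ) (J : Set ℝ) : Prop :=
  Maximal (fun K : Set ℝ => IsOpen K ∧ K.OrdConnected ∧ ∀ ξ ∈ K, 0 < φ ξ ∧ φ ξ < ρbar) J

/-- Convergence in `C¹_loc(J)` of functions `φ n`, defined on the sets `I n`, to `φ₀`: the limit
is `C¹` in `J` and, for each compact `K ⊆ J`, the function `φ n` is defined and `C¹` near `K` for all
large `n`, and `φ n → φ₀`, `(φ n)' → φ₀'` uniformly on `K`. -/
def TendstoC1Loc (I : ℕ → Set ℝ) (φ : ℕ → ℝ → ℝ) (φ₀ : ℝ → ℝ) (J : Set ℝ) : Prop :=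
  ContDiffOn ℝ 1 φ₀ J ∧
    ∀ K : Set ℝ, IsCompact K → K ⊆ J →
      (∀ᶠ n in atTop, ∃ U : Set ℝ, IsOpen U ∧ K ⊆ U ∧ U ⊆ I n ∧ ContDiffOn ℝ 1 (φ n) U) ∧
      TendstoUniformlyOn φ φ₀ atTop K ∧
      TendstoUniformlyOn (fun n => deriv (φ n)) (deriv φ₀) atTop K

end SemiWave

namespace SemiWave

/-! The convergence is proved in the phase plane. By the weak equation, the flux `v = D(φ)φ' - f(φ)
+ cφ` is an antiderivative of `-g(φ)`, hence nonincreasing. This forces `φ` to be nonincreasing,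
with `φ' < 0` wherever `0 < φ < ρbar` (`FluxProfile.antitoneOn`, `FluxProfile.deriv_neg`). The
inverse profile `y` and `Z = D(φ)φ' < 0` are then functions of the density, and `(Z - f + cρ)' =
-gD/Z`, `y' = D/Z`, `Z → 0` at `ρbar`. A semi-wavefront profile reaches every density in `(0,
ρbar)`: if it stayed away from `0` it could be continued past its end point, against maximality
(`FluxProfile.exists_extension`).

In these variables the source enters monotonically: a larger `g` gives a smaller `Z`
(`PhaseTrajectory.le_of_source_le`). If moreover `g₁ ≤ g₂ + ε`, then `Z₂ - Z₁ - ε y₂` is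
nondecreasing (`PhaseTrajectory.sub_le_of_source_le`), so the gap between the trajectories at `ρ` is
controlled by the gap at a density `r` near `ρbar` plus `ε` times a travel time of the limit
profile. As the sources decrease with `n`, all gaps at `r` are at most the size of the first
trajectory there, which is small. So `Z` converges locally uniformly, then `y` by integrating `D/Z`
from the common value at `ρbar/2`, then `φ` by inversion, and finally `φ' = Z(φ)/D(φ)`. -/

/-! ### Absolute continuity, test functions and the weak equation -/

/-- Absolute continuity is additive with respect to adjacent intervals. -/
theorem absolutelyContinuousOnInterval_trans {u : ℝ → ℝ} {a m b : ℝ} (ham : a ≤ m) (hmb : m ≤ b)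
    (h₁ : AbsolutelyContinuousOnInterval u a m) (h₂ : AbsolutelyContinuousOnInterval u m b) :
    AbsolutelyContinuousOnInterval u a b := by
  have i₁ := h₁.intervalIntegrable_deriv
  have i₂ := h₂.intervalIntegrable_deriv
  have key : ∀ x ∈ uIcc a b, u x = u a + ∫ t in a..x, deriv u t := by
    intro x hx
    rw [uIcc_of_le (ham.trans hmb)] at hx
    rcases le_total x m with hxm | hmx
    · have : AbsolutelyContinuousOnInterval u a x := h₁.mono (by
        rw [uIcc_of_le hx.1, uIcc_of_le ham]; exact Icc_subset_Icc_right hxm)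
      rw [this.integral_deriv_eq_sub]; ring
    · have : AbsolutelyContinuousOnInterval u m x := h₂.mono (by
        rw [uIcc_of_le hmx, uIcc_of_le hmb]; exact Icc_subset_Icc_right hx.2)
      rw [← intervalIntegral.integral_add_adjacent_intervals i₁ this.intervalIntegrable_deriv,
        this.integral_deriv_eq_sub, h₁.integral_deriv_eq_sub]; ring
  have hI : AbsolutelyContinuousOnInterval (fun x => ∫ t in a..x, deriv u t) a b :=
    (i₁.trans i₂).absolutelyContinuousOnInterval_intervalIntegral left_mem_uIcc
  have hc : AbsolutelyContinuousOnInterval (fun _ : ℝ => u a) a b :=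
    contDiffOn_const.absolutelyContinuousOnInterval
  have hsum := hc.add hI
  -- `u` agrees with the sum only on `[a, b]`, so the transfer goes through the ε-δ form, which sees
  -- only values there.
  rw [absolutelyContinuousOnInterval_iff] at hsum ⊢
  intro ε hε
  obtain ⟨δ, hδ, H⟩ := hsum ε hε
  refine ⟨δ, hδ, fun E hE hlt => ?_⟩
  convert H E hE hlt using 1
  refine Finset.sum_congr rfl fun i hi => ?_
  have := hE.1 i hi
  simp only [Pi.add_apply]
  rw [key _ this.1, key _ this.2]

/-- A function whose integral against derivatives of test functions vanishes on an interval is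
almost everywhere constant there (du Bois-Reymond lemma). -/
theorem ae_const_of_integral_mul_deriv_eq_zero {I : Set ℝ} (hI : IsOpen I) (hc : I.OrdConnected)
    (hne : I.Nonempty) {w : ℝ → ℝ} (hw : LocallyIntegrableOn w I)
    (h : ∀ ψ : ℝ → ℝ, ContDiff ℝ ∞ ψ → HasCompactSupport ψ → tsupport ψ ⊆ I →
      ∫ x in I, w x * deriv ψ x = 0) :
    ∃ k : ℝ, ∀ᵐ x ∂(volume.restrict I), w x = k := by
  obtain ⟨p, hp⟩ := hne
  obtain ⟨r, hr, hball⟩ := Metric.isOpen_iff.1 hI p hp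
  let b : ContDiffBump p := ⟨r / 4, r / 2, by positivity, by linarith⟩
  set η : ℝ → ℝ := b.normed volume with hη
  have ηs : ContDiff ℝ ∞ η := b.contDiff_normed
  have ηc : HasCompactSupport η := b.hasCompactSupport_normed
  have ηI : tsupport η ⊆ I := by
    rw [hη, b.tsupport_normed_eq]
    exact (Metric.closedBall_subset_ball (by simp only [b]; linarith)).trans hball
  have η1 : ∫ x, η x = 1 := b.integral_normed
  have wint : ∀ χ : ℝ → ℝ, Continuous χ → HasCompactSupport χ → tsupport χ ⊆ I →
      IntegrableOn (fun x => w x * χ x) I := by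
    intro χ χs χc χI
    have h1 : IntegrableOn (fun x => w x * χ x) (tsupport χ) :=
      (hw.integrableOn_compact_subset χI χc).mul_continuousOn χs.continuousOn χc
    refine IntegrableOn.of_forall_sdiff_eq_zero h1 hI.measurableSet fun x hx => ?_
    rw [image_eq_zero_of_notMem_tsupport hx.2, mul_zero]
  set k := ∫ x in I, w x * η x with hk
  refine ⟨k, ?_⟩
  have hloc : LocallyIntegrableOn (fun x => w x - k) I :=
    hw.sub ((locallyIntegrable_const k).locallyIntegrableOn I)
  have := hI.ae_eq_zero_of_integral_contDiff_smul_eq_zero hloc (fun χ χs χc χI => by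
    set m := ∫ x, χ x with hm
    -- Subtracting `m η` makes the integral vanish, so that the primitive of `θ` has compact support
    -- and is an admissible test function.
    set θ : ℝ → ℝ := fun x => χ x - m * η x with hθ
    have θs : ContDiff ℝ ∞ θ := χs.sub (contDiff_const.mul ηs)
    have θc : Continuous θ := θs.continuous
    set K := tsupport χ ∪ tsupport η ∪ {p} with hK
    have Kc : IsCompact K := (χc.isCompact.union ηc.isCompact).union isCompact_singleton
    have Kne : K.Nonempty := ⟨p, by simp [hK]⟩
    have KI : K ⊆ I := by
      rintro x ((hx | hx) | rfl)
      exacts [χI hx, ηI hx, hp]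
    set A := sInf K
    set B := sSup K
    have hA : A ∈ I := KI (Kc.sInf_mem Kne)
    have hB : B ∈ I := KI (Kc.sSup_mem Kne)
    have θ0 : ∀ x, x ∉ Icc A B → θ x = 0 := by
      intro x hx
      have : x ∉ K := fun hxK => hx ⟨csInf_le Kc.bddBelow hxK, le_csSup Kc.bddAbove hxK⟩
      simp only [hK, mem_union, not_or] at this
      simp [hθ, image_eq_zero_of_notMem_tsupport this.1.1,
        image_eq_zero_of_notMem_tsupport this.1.2]
    have iχ : Integrable χ := χs.continuous.integrable_of_hasCompactSupport χc
    have iη : Integrable η := ηs.continuous.integrable_of_hasCompactSupport ηc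
    have θint : ∫ x, θ x = 0 := by
      simp only [hθ]
      rw [integral_sub iχ (iη.const_mul m), integral_const_mul, η1]; simp [hm]
    set ψ : ℝ → ℝ := fun x => ∫ t in A..x, θ t with hψ
    have ψd : ∀ x, HasDerivAt ψ (θ x) x := fun x =>
      intervalIntegral.integral_hasDerivAt_right (θc.intervalIntegrable _ _)
        (θc.stronglyMeasurableAtFilter _ _) θc.continuousAt
    have dψ : deriv ψ = θ := funext fun x => (ψd x).deriv
    have ψs : ContDiff ℝ ∞ ψ := by
      rw [contDiff_infty_iff_deriv]
      exact ⟨fun x => (ψd x).differentiableAt, by rw [dψ]; exact θs⟩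
    have ψ0 : ∀ x, x ∉ Icc A B → ψ x = 0 := by
      intro x hx
      have hAB : A ≤ B := csInf_le_csSup Kne Kc.bddBelow Kc.bddAbove
      rcases lt_or_ge x A with h1 | h1
      · simp only [hψ]
        rw [intervalIntegral.integral_symm, intervalIntegral.integral_of_le h1.le,
          integral_Ioc_eq_integral_Ioo, setIntegral_eq_zero_of_forall_eq_zero, neg_zero]
        exact fun t ht => θ0 t fun h' => absurd h'.1 (not_le.2 ht.2)
      · have h2 : B < x := by
          by_contra h3; exact hx ⟨h1, not_lt.1 h3⟩
        simp only [hψ]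
        rw [intervalIntegral.integral_of_le h1, ← integral_Icc_eq_integral_Ioc,
          setIntegral_eq_integral_of_forall_compl_eq_zero, θint]
        exact fun t ht => θ0 t fun h' => ht ⟨h'.1, h'.2.trans h2.le⟩
    have ψsupp : tsupport ψ ⊆ Icc A B :=
      closure_minimal (fun x hx => by_contra fun h' => hx (ψ0 x h')) isClosed_Icc
    have key := h ψ ψs (HasCompactSupport.of_support_subset_isCompact isCompact_Icc
      (subset_closure.trans ψsupp)) (ψsupp.trans (hc.out hA hB))
    rw [dψ] at key
    have e1 : ∫ x in I, w x * θ x = (∫ x in I, w x * χ x) - m * k := by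
      rw [hk, ← integral_const_mul, ← integral_sub (wint χ χs.continuous χc χI)
        ((wint η ηs.continuous ηc ηI).const_mul m)]
      congr 1; ext x; simp only [hθ]; ring
    have e2 : ∫ x, χ x • (w x - k) = ∫ x in I, (w x * χ x - k * χ x) := by
      rw [← setIntegral_eq_integral_of_forall_compl_eq_zero (s := I)]
      · congr 1; ext x; simp only [smul_eq_mul]; ring
      · intro x hx
        rw [image_eq_zero_of_notMem_tsupport fun h' => hx (χI h'), zero_smul]
    have e3 : ∫ x in I, χ x = m := by
      rw [hm, setIntegral_eq_integral_of_forall_compl_eq_zero]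
      exact fun x hx => image_eq_zero_of_notMem_tsupport fun h' => hx (χI h')
    rw [e2, integral_sub (wint χ χs.continuous χc χI) (iχ.integrableOn.const_mul k),
      integral_const_mul, e3]
    linarith)
  rw [ae_restrict_iff' hI.measurableSet]
  filter_upwards [this] with x hx hxI
  linarith [hx hxI]

/-- Integration by parts against a test function. -/
theorem integral_mul_deriv_add_eq_zero {I : Set ℝ} {G q ψ : ℝ → ℝ}
    (hG : ∀ x ∈ I, HasDerivAt G (q x) x) (hq : ContinuousOn q I)
    (ψs : ContDiff ℝ ∞ ψ) (ψc : HasCompactSupport ψ) (ψI : tsupport ψ ⊆ I) :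
    IntegrableOn (fun x => G x * deriv ψ x) I ∧ IntegrableOn (fun x => q x * ψ x) I ∧
    ∫ x in I, (G x * deriv ψ x + q x * ψ x) = 0 := by
  have Gc : ContinuousOn G I := fun x hx => (hG x hx).continuousAt.continuousWithinAt
  have cd : Continuous (deriv ψ) := ψs.continuous_deriv (by simp)
  have z1 : ∀ x, x ∉ tsupport ψ → ψ x = 0 := fun x hx => image_eq_zero_of_notMem_tsupport hx
  have z2 : ∀ x, x ∉ tsupport ψ → deriv ψ x = 0 := fun x hx =>
    image_eq_zero_of_notMem_tsupport fun h' => hx (tsupport_deriv_subset h')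
  have i0 : ∀ p r : ℝ → ℝ, ContinuousOn p I → Continuous r → (∀ x, x ∉ tsupport ψ → r x = 0) →
      Integrable (fun x => p x * r x) := by
    intro p r hp hr h0
    have h1 : IntegrableOn (fun x => p x * r x) (tsupport ψ) :=
      ((hp.mono ψI).mul hr.continuousOn).integrableOn_compact ψc
    rw [← integrableOn_univ]
    refine IntegrableOn.of_forall_sdiff_eq_zero h1 MeasurableSet.univ fun x hx => ?_
    rw [h0 x hx.2, mul_zero]
  have i1 := i0 G (deriv ψ) Gc cd z2
  have i2 := i0 q ψ hq ψs.continuous z1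
  refine ⟨i1.integrableOn, i2.integrableOn, ?_⟩
  rw [setIntegral_eq_integral_of_forall_compl_eq_zero]
  · refine integral_eq_zero_of_hasDerivAt_of_integrable (f := fun x => G x * ψ x) ?_ (i1.add i2)
      (i0 G ψ Gc ψs.continuous z1)
    intro x
    by_cases hx : x ∈ tsupport ψ
    · have := (hG x (ψI hx)).fun_mul (ψs.differentiable (by simp) x).hasDerivAt
      exact this.congr_deriv (add_comm _ _)
    · have e : (fun x => G x * ψ x) =ᶠ[𝓝 x] fun _ => 0 := by
        filter_upwards [(isClosed_tsupport ψ).isOpen_compl.mem_nhds hx] with t ht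
        rw [z1 t ht, mul_zero]
      rw [z1 x hx, z2 x hx, mul_zero, mul_zero, add_zero]
      exact (hasDerivAt_const x (0 : ℝ)).congr_of_eventuallyEq e
  · intro x hx
    have : x ∉ tsupport ψ := fun h' => hx (ψI h')
    rw [z1 x this, z2 x this]; ring

/-- The weak equation in integrated form: the flux is an antiderivative of `-g(φ)`. -/
theorem exists_antiderivative_of_weak {I : Set ℝ} (hI : IsOpen I) (hc : I.OrdConnected)
    (hne : I.Nonempty) {w q : ℝ → ℝ} (hw : LocallyIntegrableOn w I) (hq : ContinuousOn q I)
    (h : ∀ ψ : ℝ → ℝ, ContDiff ℝ ∞ ψ → HasCompactSupport ψ → tsupport ψ ⊆ I →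
      ∫ x in I, (w x * deriv ψ x - q x * ψ x) = 0) :
    ∃ v : ℝ → ℝ, (∀ x ∈ I, HasDerivAt v (-q x) x) ∧ ∀ᵐ x ∂(volume.restrict I), w x = v x := by
  obtain ⟨p, hp⟩ := hne
  set G : ℝ → ℝ := fun x => ∫ t in p..x, q t with hGdef
  have hG : ∀ x ∈ I, HasDerivAt G (q x) x := fun x hx =>
    intervalIntegral.integral_hasDerivAt_right
      ((hq.mono (hc.uIcc_subset hp hx)).intervalIntegrable)
      (hq.stronglyMeasurableAtFilter hI x hx) (hq.continuousAt (hI.mem_nhds hx))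
  have Gc : ContinuousOn G I := fun x hx => (hG x hx).continuousAt.continuousWithinAt
  -- Moving `q` onto `ψ'` by parts, the weak equation says that `w + G` is orthogonal to every `ψ'`.
  obtain ⟨k, hk⟩ := ae_const_of_integral_mul_deriv_eq_zero hI hc ⟨p, hp⟩
    (w := fun x => w x + G x) (hw.add (Gc.locallyIntegrableOn hI.measurableSet))
    (fun ψ ψs ψc ψI => by
      obtain ⟨j1, j2, j3⟩ := integral_mul_deriv_add_eq_zero hG hq ψs ψc ψI
      have cd : Continuous (deriv ψ) := ψs.continuous_deriv (by simp)
      have z2 : ∀ x, x ∉ tsupport ψ → deriv ψ x = 0 := fun x hx =>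
        image_eq_zero_of_notMem_tsupport fun h' => hx (tsupport_deriv_subset h')
      have j4 : IntegrableOn (fun x => w x * deriv ψ x) I := by
        refine IntegrableOn.of_forall_sdiff_eq_zero (s := tsupport ψ)
          ((hw.integrableOn_compact_subset ψI ψc).mul_continuousOn cd.continuousOn ψc)
          hI.measurableSet fun x hx => ?_
        rw [z2 x hx.2, mul_zero]
      have := h ψ ψs ψc ψI
      rw [integral_sub j4 j2] at this
      rw [integral_add j1 j2] at j3
      simp only [add_mul]
      rw [integral_add j4 j1]
      linarith)
  refine ⟨fun x => k - G x, fun x hx => ?_, ?_⟩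
  · simpa using (hG x hx).const_sub k
  · filter_upwards [hk] with x hx
    linarith

/-! ### One-sided derivative signs, level crossings, inverse functions -/

theorem deriv_nonpos_of_eventually_right {u : ℝ → ℝ} {d x : ℝ} (hu : HasDerivAt u d x)
    (h : ∀ᶠ t in 𝓝[>] x, u t ≤ u x) : d ≤ 0 := by
  have h1 : Tendsto (slope u x) (𝓝[>] x) (𝓝 d) :=
    (hasDerivAt_iff_tendsto_slope.1 hu).mono_left (nhdsWithin_mono x fun t ht => ne_of_gt ht)
  refine le_of_tendsto h1 ?_
  filter_upwards [h, self_mem_nhdsWithin] with t ht htx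
  rw [slope_def_field]
  exact div_nonpos_of_nonpos_of_nonneg (by linarith) (by linarith [mem_Ioi.1 htx])

theorem deriv_nonneg_of_eventually_left {u : ℝ → ℝ} {d x : ℝ} (hu : HasDerivWithinAt u d (Iio x) x)
    (h : ∀ᶠ t in 𝓝[<] x, u t ≤ u x) : 0 ≤ d := by
  have h1 : Tendsto (slope u x) (𝓝[<] x) (𝓝 d) :=
    (hasDerivWithinAt_iff_tendsto_slope' (by simp)).1 hu
  refine ge_of_tendsto h1 ?_
  filter_upwards [h, self_mem_nhdsWithin] with t ht htx
  rw [slope_def_field]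
  exact div_nonneg_of_nonpos (by linarith) (by linarith [mem_Iio.1 htx])

theorem exists_last_crossing {u : ℝ → ℝ} {a b ρ : ℝ} (hab : a ≤ b) (hu : ContinuousOn u (Icc a b))
    (ha : ρ ≤ u a) (hb : u b < ρ) :
    ∃ y ∈ Ico a b, u y = ρ ∧ ∀ t ∈ Ioc y b, u t < ρ := by
  set T := Icc a b ∩ u ⁻¹' Ici ρ with hT
  have Tc : IsCompact T := isCompact_Icc.of_isClosed_subset
    (hu.preimage_isClosed_of_isClosed isClosed_Icc isClosed_Ici) inter_subset_left
  have Tne : T.Nonempty := ⟨a, left_mem_Icc.2 hab, ha⟩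
  have hy : sSup T ∈ T := Tc.sSup_mem Tne
  set y := sSup T
  have hyb : y < b := lt_of_le_of_ne hy.1.2 fun h => absurd hy.2 (by rw [h]; exact not_le.2 hb)
  refine ⟨y, ⟨hy.1.1, hyb⟩, ?_, fun t ht => ?_⟩
  · obtain ⟨t, ht, hρ⟩ := intermediate_value_Icc' hyb.le
      (hu.mono (Icc_subset_Icc_left hy.1.1)) ⟨hb.le, hy.2⟩
    have : t ≤ y := le_csSup Tc.bddAbove ⟨⟨hy.1.1.trans ht.1, ht.2⟩, hρ.ge⟩
    rwa [le_antisymm this ht.1] at hρ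
  · by_contra h
    exact absurd (le_csSup Tc.bddAbove ⟨⟨hy.1.1.trans ht.1.le, ht.2⟩, not_lt.1 h⟩)
      (not_le.2 ht.1)

theorem exists_first_crossing {u : ℝ → ℝ} {a b ρ : ℝ} (hab : a ≤ b) (hu : ContinuousOn u (Icc a b))
    (ha : u a < ρ) (hb : ρ ≤ u b) :
    ∃ x ∈ Ioc a b, u x = ρ ∧ ∀ t ∈ Ico a x, u t < ρ := by
  obtain ⟨y, hy, h1, h2⟩ := exists_last_crossing (u := fun t => u (-t)) (a := -b) (b := -a)
    (neg_le_neg hab) (hu.comp continuous_neg.continuousOn fun t ht =>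
      ⟨by linarith [ht.2], by linarith [ht.1]⟩) (by simpa using hb) (by simpa using ha)
  refine ⟨-y, ⟨by linarith [hy.2], by linarith [hy.1]⟩, h1, fun t ht => ?_⟩
  simpa using h2 (-t) ⟨by linarith [ht.2], by linarith [ht.1]⟩

/-- A function with continuous negative derivative on an interval has a differentiable inverse. -/
theorem exists_leftInverse_hasDerivAt {C : Set ℝ} (hC : IsOpen C) (hc : C.OrdConnected)
    {u u' : ℝ → ℝ} (hu : ∀ x ∈ C, HasDerivAt u (u' x) x) (hneg : ∀ x ∈ C, u' x < 0)
    (hcont : ContinuousOn u' C) :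
    StrictAntiOn u C ∧ ∃ w : ℝ → ℝ, ∀ x ∈ C, w (u x) = x ∧ HasDerivAt w (u' x)⁻¹ (u x) := by
  have hanti : StrictAntiOn u C := strictAntiOn_of_deriv_neg hc.convex
    (fun x hx => (hu x hx).continuousAt.continuousWithinAt) fun x hx => by
      rw [(hu x (interior_subset hx)).deriv]; exact hneg x (interior_subset hx)
  have hl : ∀ x ∈ C, Function.invFunOn u C (u x) = x := fun x hx =>
    hanti.injOn (Function.invFunOn_mem ⟨x, hx, rfl⟩) hx (Function.invFunOn_eq ⟨x, hx, rfl⟩)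
  refine ⟨hanti, Function.invFunOn u C, fun x hx => ⟨hl x hx, ?_⟩⟩
  have st : HasStrictDerivAt u (u' x) x := by
    refine hasStrictDerivAt_of_hasDerivAt_of_continuousAt ?_ (hcont.continuousAt (hC.mem_nhds hx))
    filter_upwards [hC.mem_nhds hx] with t ht using hu t ht
  refine (st.to_local_left_inverse (hneg x hx).ne ?_).hasDerivAt
  filter_upwards [hC.mem_nhds hx] with t ht using hl t ht

/-! ### Profiles in integrated form: monotonicity and regularity -/

/-- The conditions on the flux, the diffusivity and the source term that are used
for all the equations. -/
structure Coefficients (ρbar : ℝ) (f D g : ℝ → ℝ) : Prop where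
  pos : 0 < ρbar
  flux : ContDiffOn ℝ 1 f (Icc 0 ρbar)
  diff : ContinuousOn D (Icc 0 ρbar)
  diff_pos : ∀ ρ ∈ Ioo 0 ρbar, 0 < D ρ
  source : ContinuousOn g (Icc 0 ρbar)
  source_nonneg : ∀ ρ ∈ Icc 0 ρbar, 0 ≤ g ρ
  source_pos : ∀ ρ ∈ Ioo 0 ρbar, 0 < g ρ

/-- A profile `φ` coming from `ρbar`, together with the antiderivative `v` of `-g(φ)` that
equals `D(φ) φ' - f(φ) + c φ`. -/
structure FluxProfile (ρbar : ℝ) (f D g : ℝ → ℝ) (c : ℝ) (I : Set ℝ) (φ v : ℝ → ℝ) : Prop where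
  isOpen : IsOpen I
  isLowerSet : IsLowerSet I
  nonempty : I.Nonempty
  mapsTo : MapsTo φ I (Icc 0 ρbar)
  continuousOn : ContinuousOn φ I
  hasDerivAt_flux : ∀ ξ ∈ I, HasDerivAt v (-g (φ ξ)) ξ
  differentiableAt : ∀ ξ ∈ I, φ ξ ∈ Ioo 0 ρbar → DifferentiableAt ℝ φ ξ
  flux_eq : ∀ ξ ∈ I, φ ξ ∈ Ioo 0 ρbar → D (φ ξ) * deriv φ ξ = v ξ + f (φ ξ) - c * φ ξ
  flux_eq_right : ∀ ξ ∈ I, (∀ᶠ x in 𝓝 ξ, φ x = ρbar) → v ξ = c * ρbar - f ρbar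
  tendsto : Tendsto φ atBot (𝓝 ρbar)

/-- The weak equation identifies the flux only almost everywhere. Off `S`, absolute continuity makes
`D(φ)φ'` continuous, and two continuous functions that agree almost everywhere on an open set agree
on all of it. -/
theorem IsTravelingWave.exists_flux {ρbar : ℝ} {f D g : ℝ → ℝ} {c : ℝ} {I S : Set ℝ} {φ : ℝ → ℝ}
    (H : Coefficients ρbar f D g) (hφ : IsTravelingWave ρbar f D g c I φ) (hne : I.Nonempty)
    (hS : S.Finite) (hcl : IsClassicalOn ρbar f D g c (I \ S) φ) :
    ∃ v : ℝ → ℝ, (∀ ξ ∈ I, HasDerivAt v (-g (φ ξ)) ξ) ∧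
      (∀ᵐ ξ ∂(volume.restrict I), D (φ ξ) * deriv φ ξ - f (φ ξ) + c * φ ξ = v ξ) ∧
      ∀ ξ ∈ I \ S, D (φ ξ) * deriv φ ξ = v ξ + f (φ ξ) - c * φ ξ := by
  have fc : ContinuousOn (fun ξ => f (φ ξ)) I := H.flux.continuousOn.comp hφ.continuousOn hφ.mapsTo
  have gc : ContinuousOn (fun ξ => g (φ ξ)) I := H.source.comp hφ.continuousOn hφ.mapsTo
  have cc : ContinuousOn (fun ξ => c * φ ξ) I := continuousOn_const.mul hφ.continuousOn
  have hm := hφ.isOpen.measurableSet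
  obtain ⟨v, hv, hae⟩ := exists_antiderivative_of_weak hφ.isOpen hφ.ordConnected hne
    (w := fun ξ => D (φ ξ) * deriv φ ξ - f (φ ξ) + c * φ ξ)
    ((hφ.locallyIntegrableOn.sub (fc.locallyIntegrableOn hm)).add (cc.locallyIntegrableOn hm))
    gc hφ.weak
  refine ⟨v, hv, hae, ?_⟩
  have vc : ContinuousOn v I := fun x hx => (hv x hx).continuousAt.continuousWithinAt
  have Uo : IsOpen (I \ S) := hφ.isOpen.sdiff hS.isClosed
  have uc : ContinuousOn (fun ξ => D (φ ξ) * deriv φ ξ) (I \ S) := by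
    intro x hx
    obtain ⟨ε, hε, hb⟩ := Metric.nhds_basis_closedBall.mem_iff.1 (Uo.mem_nhds hx)
    rw [Real.closedBall_eq_Icc] at hb
    have := (hcl.absolutelyContinuous (x - ε) (x + ε) (by linarith) hb).continuousOn
    rw [uIcc_of_le (by linarith)] at this
    exact (this.continuousAt (Icc_mem_nhds (by linarith) (by linarith))).continuousWithinAt
  refine Measure.eqOn_open_of_ae_eq (μ := volume) ?_ Uo uc
    (((vc.add fc).sub cc).mono sdiff_subset)
  filter_upwards [ae_restrict_of_ae_restrict_of_subset sdiff_subset hae] with x hx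
  linarith

/-- The exceptional points are harmless: where `0 < φ < ρbar` they cannot occur because `g > 0`, and
where `φ` is locally `ρbar` they cannot occur because `φ` is differentiable. -/
theorem FluxProfile.of_travelingWave {ρbar : ℝ} {f D g : ℝ → ℝ} {c : ℝ} {I S : Set ℝ}
    {φ v : ℝ → ℝ}
    (H : Coefficients ρbar f D g) (hφ : IsTravelingWave ρbar f D g c I φ) (hne : I.Nonempty)
    (hlow : IsLowerSet I) (hS : ∀ ξ ∈ S, g (φ ξ) = 0 ∧ ¬ DifferentiableAt ℝ φ ξ)
    (hcl : IsClassicalOn ρbar f D g c (I \ S) φ) (hlim : Tendsto φ atBot (𝓝 ρbar))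
    (hv : ∀ ξ ∈ I, HasDerivAt v (-g (φ ξ)) ξ)
    (heq : ∀ ξ ∈ I \ S, D (φ ξ) * deriv φ ξ = v ξ + f (φ ξ) - c * φ ξ) :
    FluxProfile ρbar f D g c I φ v := by
  have hnS : ∀ ξ ∈ I, φ ξ ∈ Ioo 0 ρbar → ξ ∈ I \ S := fun ξ hξ h =>
    ⟨hξ, fun hs => absurd (hS ξ hs).1 (H.source_pos _ h).ne'⟩
  refine ⟨hφ.isOpen, hlow, hne, hφ.mapsTo, hφ.continuousOn, hv,
    fun ξ hξ h => hcl.differentiableAt ξ (hnS ξ hξ h), fun ξ hξ h => heq ξ (hnS ξ hξ h),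
    fun ξ hξ h => ?_, hlim⟩
  have : ξ ∈ I \ S := ⟨hξ, fun hs => (hS ξ hs).2
    ((differentiableAt_const ρbar).congr_of_eventuallyEq h)⟩
  have e := heq ξ this
  have e2 : φ ξ = ρbar := h.self_of_nhds
  have e3 : deriv φ ξ = 0 := by
    rw [EventuallyEq.deriv_eq (f := fun _ => ρbar) h]; simp
  rw [e3, e2] at e
  linarith

namespace FluxProfile

variable {ρbar : ℝ} {f D g : ℝ → ℝ} {c : ℝ} {I : Set ℝ} {φ v : ℝ → ℝ}

theorem convex (P : FluxProfile ρbar f D g c I φ v) : Convex ℝ I :=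
  P.isLowerSet.ordConnected.convex

theorem antitoneOn_flux (H : Coefficients ρbar f D g) (P : FluxProfile ρbar f D g c I φ v) :
    AntitoneOn v I := by
  refine antitoneOn_of_deriv_nonpos P.convex
    (fun x hx => (P.hasDerivAt_flux x hx).continuousAt.continuousWithinAt)
    (fun x hx => (P.hasDerivAt_flux x (interior_subset hx)).differentiableAt.differentiableWithinAt)
    fun x hx => ?_
  rw [(P.hasDerivAt_flux x (interior_subset hx)).deriv, neg_nonpos]
  exact H.source_nonneg _ (P.mapsTo (interior_subset hx))

/-- If `φ` rose, some level `ρ` would be crossed downwards at `y` (since `φ` starts near `ρbar`) and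
later upwards at `x`. At equal levels the terms in `f` and `c` cancel, so the signs of `φ'` give `v
y ≤ v x`. As `v` is nonincreasing, it cannot decrease just after `y`, against `v' = -g(ρ) < 0`
there. -/
theorem antitoneOn (H : Coefficients ρbar f D g) (P : FluxProfile ρbar f D g c I φ v) :
    AntitoneOn φ I := by
  intro a ha b hb hab
  by_contra! hlt
  obtain ⟨ρ, hρa, hρb⟩ := exists_between hlt
  have hρ : ρ ∈ Ioo 0 ρbar := ⟨(P.mapsTo ha).1.trans_lt hρa, hρb.trans_le (P.mapsTo hb).2⟩
  obtain ⟨e, he, hea⟩ := ((P.tendsto.eventually_const_lt hρ.2).and (eventually_le_atBot a)).exists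
  have cont : ∀ s, s ≤ b → ∀ r, ContinuousOn φ (Icc r s) := fun s hs r =>
    P.continuousOn.mono fun t ht => P.isLowerSet (ht.2.trans hs) hb
  obtain ⟨y, hy, hyρ, hy2⟩ := exists_last_crossing hea (cont a hab e) he.le hρa
  obtain ⟨x, hx, hxρ, hx2⟩ := exists_first_crossing hab (cont b le_rfl a) hρa hρb.le
  have hyI : y ∈ I := P.isLowerSet hy.2.le ha
  have hxI : x ∈ I := P.isLowerSet hx.2 hb
  have hyx : y < x := hy.2.trans hx.1
  have dy : deriv φ y ≤ 0 := by
    refine deriv_nonpos_of_eventually_right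
      (P.differentiableAt y hyI (by rwa [hyρ])).hasDerivAt ?_
    filter_upwards [Ioc_mem_nhdsGT hy.2] with t ht
    rw [hyρ]; exact (hy2 t ht).le
  have dx : 0 ≤ deriv φ x := by
    refine deriv_nonneg_of_eventually_left
      (P.differentiableAt x hxI (by rwa [hxρ])).hasDerivAt.hasDerivWithinAt ?_
    filter_upwards [Ico_mem_nhdsLT hx.1] with t ht
    rw [hxρ]; exact (hx2 t ht).le
  have ey := P.flux_eq y hyI (by rwa [hyρ])
  have ex := P.flux_eq x hxI (by rwa [hxρ])
  rw [hyρ] at ey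
  rw [hxρ] at ex
  have hDρ := H.diff_pos ρ hρ
  have hle : v y ≤ v x := by
    have := mul_nonpos_of_nonneg_of_nonpos hDρ.le dy
    have := mul_nonneg hDρ.le dx
    linarith
  have hd := deriv_nonpos_of_eventually_right (P.hasDerivAt_flux y hyI).neg (by
    filter_upwards [Ioc_mem_nhdsGT hyx] with t ht
    have : v x ≤ v t := P.antitoneOn_flux H (P.isLowerSet ht.2 hxI) hxI ht.2
    simp only [Pi.neg_apply]
    linarith)
  rw [hyρ, neg_neg] at hd
  exact absurd (H.source_pos ρ hρ) (not_lt.2 hd)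

theorem isOpen_active (P : FluxProfile ρbar f D g c I φ v) : IsOpen (I ∩ φ ⁻¹' Ioo 0 ρbar) :=
  P.continuousOn.isOpen_inter_preimage P.isOpen isOpen_Ioo

theorem ordConnected_active (H : Coefficients ρbar f D g) (P : FluxProfile ρbar f D g c I φ v) :
    (I ∩ φ ⁻¹' Ioo 0 ρbar).OrdConnected := by
  refine ⟨fun x hx y hy t ht => ?_⟩
  have htI : t ∈ I := P.isLowerSet ht.2 hy.1
  exact ⟨htI, hy.2.1.trans_le (P.antitoneOn H htI hy.1 ht.2),
    (P.antitoneOn H hx.1 htI ht.1).trans_lt hx.2.2⟩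

/-- `D` is only continuous and `φ'` need not be differentiable, so no product rule applies to
`D(φ)φ'`. Its expression through `v` and `φ` is differentiable, and this gives the equation at every
point instead of almost everywhere. -/
theorem hasDerivAt_flux_active (H : Coefficients ρbar f D g)
    (P : FluxProfile ρbar f D g c I φ v) {ξ : ℝ} (hξ : ξ ∈ I ∩ φ ⁻¹' Ioo 0 ρbar) :
    HasDerivAt (fun t => v t + f (φ t) - c * φ t)
      (-((c - h ρbar f (φ ξ)) * deriv φ ξ + g (φ ξ))) ξ := by
  have hd := (P.differentiableAt ξ hξ.1 hξ.2).hasDerivAt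
  have hn : Icc 0 ρbar ∈ 𝓝 (φ ξ) := Icc_mem_nhds hξ.2.1 hξ.2.2
  have hf : HasDerivAt f (h ρbar f (φ ξ)) (φ ξ) :=
    (((H.flux.differentiableOn (by simp)) (φ ξ) (mem_of_mem_nhds hn)).hasDerivWithinAt).hasDerivAt hn
  refine (((P.hasDerivAt_flux ξ hξ.1).fun_add (hf.comp ξ hd)).fun_sub
    (hd.const_mul c)).congr_deriv ?_
  ring

/-- Monotonicity gives `φ' ≤ 0`. At a zero of `φ'` the nonpositive quantity `D(φ)φ'` would have a
maximum, yet its derivative there is `-g(φ) < 0`. -/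
theorem deriv_neg (H : Coefficients ρbar f D g) (P : FluxProfile ρbar f D g c I φ v) {ξ : ℝ}
    (hξ : ξ ∈ I ∩ φ ⁻¹' Ioo 0 ρbar) : deriv φ ξ < 0 := by
  have hnon : ∀ t ∈ I ∩ φ ⁻¹' Ioo 0 ρbar, deriv φ t ≤ 0 := fun t ht => by
    refine deriv_nonpos_of_eventually_right (P.differentiableAt t ht.1 ht.2).hasDerivAt ?_
    filter_upwards [mem_nhdsWithin_of_mem_nhds (P.isOpen.mem_nhds ht.1), self_mem_nhdsWithin]
      with s hs hts
    exact P.antitoneOn H ht.1 hs (le_of_lt hts)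
  refine lt_of_le_of_ne (hnon ξ hξ) fun h0 => ?_
  have hu := P.hasDerivAt_flux_active H hξ
  rw [h0, mul_zero, zero_add] at hu
  have := deriv_nonneg_of_eventually_left hu.hasDerivWithinAt (by
    filter_upwards [mem_nhdsWithin_of_mem_nhds (P.isOpen_active.mem_nhds hξ)] with s hs
    rw [← P.flux_eq s hs.1 hs.2, ← P.flux_eq ξ hξ.1 hξ.2, h0, mul_zero]
    exact mul_nonpos_of_nonneg_of_nonpos (H.diff_pos _ hs.2).le (hnon s hs))
  linarith [H.source_pos _ hξ.2]

theorem deriv_eq (H : Coefficients ρbar f D g) (P : FluxProfile ρbar f D g c I φ v) {ξ : ℝ}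
    (hξ : ξ ∈ I ∩ φ ⁻¹' Ioo 0 ρbar) :
    deriv φ ξ = (v ξ + f (φ ξ) - c * φ ξ) / D (φ ξ) := by
  rw [eq_div_iff (H.diff_pos _ hξ.2).ne', mul_comm]
  exact P.flux_eq ξ hξ.1 hξ.2

theorem continuousOn_deriv (H : Coefficients ρbar f D g) (P : FluxProfile ρbar f D g c I φ v) :
    ContinuousOn (deriv φ) (I ∩ φ ⁻¹' Ioo 0 ρbar) := by
  have hmap : MapsTo φ (I ∩ φ ⁻¹' Ioo 0 ρbar) (Icc 0 ρbar) := fun x hx => P.mapsTo hx.1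
  have hc := P.continuousOn.mono (inter_subset_left (t := φ ⁻¹' Ioo 0 ρbar))
  have : ContinuousOn (fun ξ => (v ξ + f (φ ξ) - c * φ ξ) / D (φ ξ)) (I ∩ φ ⁻¹' Ioo 0 ρbar) :=
    ContinuousOn.div (fun ξ hξ =>
      (P.hasDerivAt_flux_active H hξ).continuousAt.continuousWithinAt)
      (H.diff.comp hc hmap) fun ξ hξ => (H.diff_pos _ hξ.2).ne'
  exact this.congr fun ξ hξ => P.deriv_eq H hξ

theorem contDiffOn (H : Coefficients ρbar f D g) (P : FluxProfile ρbar f D g c I φ v) :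
    ContDiffOn ℝ 1 φ (I ∩ φ ⁻¹' Ioo 0 ρbar) := by
  rw [show (1 : WithTop ℕ∞) = 0 + 1 from rfl, contDiffOn_succ_iff_deriv_of_isOpen P.isOpen_active]
  refine ⟨fun x hx => (P.differentiableAt x hx.1 hx.2).differentiableWithinAt, by simp, ?_⟩
  exact contDiffOn_zero.2 (P.continuousOn_deriv H)

theorem strictAntiOn (H : Coefficients ρbar f D g) (P : FluxProfile ρbar f D g c I φ v) :
    StrictAntiOn φ (I ∩ φ ⁻¹' Ioo 0 ρbar) :=
  strictAntiOn_of_deriv_neg (P.ordConnected_active H).convex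
    (P.continuousOn.mono inter_subset_left) fun _ hx => P.deriv_neg H (interior_subset hx)

/-- Near `ρbar` the flux is close to its value at the constant state `ρbar`. -/
theorem exists_flux_gt (H : Coefficients ρbar f D g) (P : FluxProfile ρbar f D g c I φ v)
    {p : ℝ} (hp : p ∈ I ∩ φ ⁻¹' Ioo 0 ρbar) {ε : ℝ} (hε : 0 < ε) :
    ∃ x ∈ I ∩ φ ⁻¹' Ioo 0 ρbar, c * ρbar - f ρbar - ε < v x := by
  -- If `ρbar` is attained, `φ` is constant up to a last such point `a`, where continuity of `v`
  -- gives its value. Otherwise `φ < ρbar` all the way to `-∞` and the value is found as a limit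
  -- along a sequence.
  by_cases hex : ∃ s ∈ I, φ s = ρbar
  · set A := {s | s ∈ I ∧ φ s = ρbar} with hA
    have Ale : ∀ s ∈ A, s ≤ p := fun s hs => by
      by_contra! h
      have := P.antitoneOn H hp.1 hs.1 h.le
      rw [hs.2] at this
      exact absurd hp.2.2 (not_lt.2 this)
    have Ane : A.Nonempty := hex
    have Abdd : BddAbove A := ⟨p, Ale⟩
    set a := sSup A
    have hap : a ≤ p := csSup_le Ane Ale
    have haI : a ∈ I := P.isLowerSet hap hp.1
    have hlt : ∀ t < a, φ t = ρbar := fun t ht => by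
      obtain ⟨s, hs, hts⟩ := exists_lt_of_lt_csSup Ane ht
      have := P.antitoneOn H (P.isLowerSet hts.le hs.1) hs.1 hts.le
      rw [hs.2] at this
      exact le_antisymm (P.mapsTo (P.isLowerSet hts.le hs.1)).2 this
    have ca : Tendsto φ (𝓝[<] a) (𝓝 (φ a)) :=
      (P.continuousOn.continuousAt (P.isOpen.mem_nhds haI)).mono_left nhdsWithin_le_nhds
    have cv : Tendsto v (𝓝[<] a) (𝓝 (v a)) :=
      (P.hasDerivAt_flux a haI).continuousAt.tendsto.mono_left nhdsWithin_le_nhds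
    have hφa : φ a = ρbar := tendsto_nhds_unique ca (tendsto_const_nhds.congr' (by
      filter_upwards [self_mem_nhdsWithin] with t ht using (hlt t ht).symm))
    have hva : v a = c * ρbar - f ρbar := tendsto_nhds_unique cv (tendsto_const_nhds.congr' (by
      filter_upwards [self_mem_nhdsWithin] with t ht
      refine (P.flux_eq_right t (P.isLowerSet (le_of_lt ht) haI) ?_).symm
      filter_upwards [Iio_mem_nhds ht] with s hs using hlt s hs))
    have hap' : a < p := lt_of_le_of_ne hap fun h => absurd hp.2.2 (by rw [← h, hφa]; simp)
    have ev : ∀ᶠ t in 𝓝[>] a, c * ρbar - f ρbar - ε < v t := by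
      refine ((P.hasDerivAt_flux a haI).continuousAt.tendsto.mono_left
        nhdsWithin_le_nhds).eventually_const_lt ?_
      rw [hva]; linarith
    obtain ⟨x, hx, hxa⟩ := (ev.and (Ioc_mem_nhdsGT hap')).exists
    have hxI : x ∈ I := P.isLowerSet hxa.2 hp.1
    refine ⟨x, ⟨hxI, hp.2.1.trans_le (P.antitoneOn H hxI hp.1 hxa.2), ?_⟩, hx⟩
    refine lt_of_le_of_ne (P.mapsTo hxI).2 fun h => ?_
    exact absurd (le_csSup Abdd (show x ∈ A from ⟨hxI, h⟩)) (not_le.2 hxa.1)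
  · push Not at hex
    have hC : ∀ t ≤ p, t ∈ I ∩ φ ⁻¹' Ioo 0 ρbar := fun t ht => by
      have htI := P.isLowerSet ht hp.1
      exact ⟨htI, hp.2.1.trans_le (P.antitoneOn H htI hp.1 ht),
        lt_of_le_of_ne (P.mapsTo htI).2 (hex t htI)⟩
    -- `φ'` is not known to have a limit at `-∞`, but the mean value theorem on unit intervals
    -- supplies points where it tends to `0`.
    have mv : ∀ n : ℕ, ∃ x ∈ Ioo (p - n - 1) (p - n), deriv φ x = φ (p - n) - φ (p - n - 1) := by
      intro n
      have hn : (0 : ℝ) ≤ n := n.cast_nonneg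
      obtain ⟨x, hx, he⟩ := exists_deriv_eq_slope φ (show p - n - 1 < p - n by linarith)
        (P.continuousOn.mono fun t ht => (hC t (ht.2.trans (by linarith))).1)
        (fun t ht => by
          have := hC t (ht.2.le.trans (by linarith))
          exact (P.differentiableAt t this.1 this.2).differentiableWithinAt)
      exact ⟨x, hx, by rw [he]; simp⟩
    choose x hx hder using mv
    have hn : Tendsto (fun n : ℕ => p - (n : ℝ)) atTop atBot :=
      tendsto_atBot_add_const_left _ p (tendsto_neg_atTop_atBot.comp tendsto_natCast_atTop_atTop)
    have hx_bot : Tendsto x atTop atBot := tendsto_atBot_mono (fun n => (hx n).2.le) hn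
    have hd0 : Tendsto (fun n => deriv φ (x n)) atTop (𝓝 0) := by
      have h1 := P.tendsto.comp hn
      have h2 := P.tendsto.comp (tendsto_atBot_add_const_right _ (-1) hn)
      have := h1.sub h2
      rw [sub_self] at this
      exact this.congr fun n => by rw [hder n]; rfl
    have hφx : Tendsto (fun n => φ (x n)) atTop (𝓝 ρbar) := P.tendsto.comp hx_bot
    have hxp : ∀ n, x n ≤ p := fun n => (hx n).2.le.trans (by linarith [n.cast_nonneg (α := ℝ)])
    have hφw : Tendsto (fun n => φ (x n)) atTop (𝓝[Icc 0 ρbar] ρbar) :=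
      tendsto_nhdsWithin_iff.2 ⟨hφx, Eventually.of_forall fun n => P.mapsTo (hC _ (hxp n)).1⟩
    have hr : ρbar ∈ Icc 0 ρbar := right_mem_Icc.2 H.pos.le
    have hDx := (H.diff ρbar hr).tendsto.comp hφw
    have hfx := (H.flux.continuousOn ρbar hr).tendsto.comp hφw
    have hv : Tendsto (fun n => v (x n)) atTop (𝓝 (D ρbar * 0 - f ρbar + c * ρbar)) := by
      refine (((hDx.mul hd0).sub hfx).add (hφx.const_mul c)).congr fun n => ?_
      have := P.flux_eq (x n) (hC _ (hxp n)).1 (hC _ (hxp n)).2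
      simp only [Function.comp_apply]
      linarith
    obtain ⟨n, hn⟩ := (hv.eventually_const_lt (show c * ρbar - f ρbar - ε < _ by linarith)).exists
    exact ⟨x n, hC _ (hxp n), hn⟩

end FluxProfile

/-! ### The phase plane -/

/-- A profile seen in the phase plane: `y` is the inverse of the profile and `Z = D(φ) φ'`, both as
functions of the density. -/
structure PhaseTrajectory (ρbar : ℝ) (f D g : ℝ → ℝ) (c : ℝ) (y Z : ℝ → ℝ) : Prop where
  neg : ∀ ρ ∈ Ioo 0 ρbar, Z ρ < 0
  hasDerivAt : ∀ ρ ∈ Ioo 0 ρbar,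
    HasDerivAt (fun r => Z r - f r + c * r) (-(g ρ * D ρ / Z ρ)) ρ
  hasDerivAt_inverse : ∀ ρ ∈ Ioo 0 ρbar, HasDerivAt y (D ρ / Z ρ) ρ
  tendsto : Tendsto Z (𝓝[<] ρbar) (𝓝 0)

/-- A decreasing profile that takes all the values between `0` and `ρbar` has a phase-plane
description. -/
theorem FluxProfile.exists_phaseTrajectory {ρbar : ℝ} {f D g : ℝ → ℝ} {c : ℝ} {I : Set ℝ}
    {φ v : ℝ → ℝ} (H : Coefficients ρbar f D g) (P : FluxProfile ρbar f D g c I φ v)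
    (hsurj : ∀ ρ ∈ Ioo 0 ρbar, ∃ x ∈ I, φ x = ρ) :
    ∃ y Z : ℝ → ℝ, PhaseTrajectory ρbar f D g c y Z ∧
      (∀ ρ ∈ Ioo 0 ρbar, y ρ ∈ I ∧ φ (y ρ) = ρ) ∧
      ∀ x ∈ I, φ x ∈ Ioo 0 ρbar → y (φ x) = x ∧ deriv φ x = Z (φ x) / D (φ x) := by
  set C := I ∩ φ ⁻¹' Ioo 0 ρbar with hC
  have hs : ∀ ρ ∈ Ioo 0 ρbar, ∃ x ∈ C, φ x = ρ := fun ρ hρ => by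
    obtain ⟨x, hx, he⟩ := hsurj ρ hρ
    exact ⟨x, ⟨hx, by rwa [mem_preimage, he]⟩, he⟩
  obtain ⟨-, y, hy⟩ := exists_leftInverse_hasDerivAt P.isOpen_active (P.ordConnected_active H)
    (fun x hx => (P.differentiableAt x hx.1 hx.2).hasDerivAt) (fun x hx => P.deriv_neg H hx)
    (P.continuousOn_deriv H)
  have yφ : ∀ x ∈ C, y (φ x) = x := fun x hx => (hy x hx).1
  have yC : ∀ ρ ∈ Ioo 0 ρbar, y ρ ∈ C := fun ρ hρ => by
    obtain ⟨x, hx, he⟩ := hs ρ hρ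
    rwa [← he, yφ x hx]
  have φy : ∀ ρ ∈ Ioo 0 ρbar, φ (y ρ) = ρ := fun ρ hρ => by
    obtain ⟨x, hx, he⟩ := hs ρ hρ
    rw [← he, yφ x hx]
  set Z : ℝ → ℝ := fun ρ => D ρ * deriv φ (y ρ) with hZ
  have Zneg : ∀ ρ ∈ Ioo 0 ρbar, Z ρ < 0 := fun ρ hρ =>
    mul_neg_of_pos_of_neg (H.diff_pos ρ hρ) (P.deriv_neg H (yC ρ hρ))
  have Zeq : ∀ ρ ∈ Ioo 0 ρbar, Z ρ = v (y ρ) + f ρ - c * ρ := fun ρ hρ => by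
    have := P.flux_eq (y ρ) (yC ρ hρ).1 (yC ρ hρ).2
    rwa [φy ρ hρ] at this
  have dy : ∀ ρ ∈ Ioo 0 ρbar, HasDerivAt y (D ρ / Z ρ) ρ := fun ρ hρ => by
    have hx := yC ρ hρ
    have hne := (P.deriv_neg H hx).ne
    have := (hy (y ρ) hx).2
    rw [φy ρ hρ] at this
    refine this.congr_deriv ?_
    have := (H.diff_pos ρ hρ).ne'
    simp only [hZ]
    field_simp
  refine ⟨y, Z, ⟨Zneg, fun ρ hρ => ?_, dy, ?_⟩, fun ρ hρ => ⟨(yC ρ hρ).1, φy ρ hρ⟩,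
    fun x hxI hx => ⟨yφ x ⟨hxI, hx⟩, ?_⟩⟩
  · have h1 := (P.hasDerivAt_flux (y ρ) (yC ρ hρ).1).comp ρ (dy ρ hρ)
    rw [φy ρ hρ] at h1
    refine (h1.congr_of_eventuallyEq ?_).congr_deriv (by ring)
    filter_upwards [isOpen_Ioo.mem_nhds hρ] with r hr
    rw [Zeq r hr, Function.comp_apply]; ring
  · have hr : ρbar ∈ Icc 0 ρbar := right_mem_Icc.2 H.pos.le
    have hfx : Tendsto f (𝓝[<] ρbar) (𝓝 (f ρbar)) := by
      refine (H.flux.continuousOn ρbar hr).tendsto.mono_left (le_inf nhdsWithin_le_nhds ?_)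
      exact le_principal_iff.2 (mem_of_superset (Ico_mem_nhdsLT H.pos) Ico_subset_Icc_self)
    have hid : Tendsto (fun r : ℝ => r) (𝓝[<] ρbar) (𝓝 ρbar) := nhdsWithin_le_nhds
    rw [Metric.tendsto_nhds]
    intro ε hε
    have hmid : ρbar / 2 ∈ Ioo 0 ρbar := ⟨by linarith [H.pos], by linarith [H.pos]⟩
    -- Densities above `φ x` are taken to the left of `x`, where `v` is at least `v x`; with `Z =
    -- v(y) + f - cρ` and `Z < 0` this squeezes `Z` to `0`.
    obtain ⟨x, hx, hvx⟩ := P.exists_flux_gt H (yC _ hmid) (half_pos hε)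
    have hlim : Tendsto (fun r => f r - f ρbar - c * (r - ρbar)) (𝓝[<] ρbar) (𝓝 0) := by
      have := (hfx.sub_const (f ρbar)).sub ((hid.sub_const ρbar).const_mul c)
      simpa using this
    filter_upwards [hlim.eventually_const_lt (show -(ε / 2) < 0 by linarith),
      Ioo_mem_nhdsLT hx.2.2] with r hr1 hr2
    have hr : r ∈ Ioo 0 ρbar := ⟨hx.2.1.trans hr2.1, hr2.2⟩
    have hyx : y r ≤ x := by
      by_contra! h
      have := P.strictAntiOn H hx (yC r hr) h
      rw [φy r hr] at this
      exact absurd hr2.1 (not_lt.2 this.le)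
    have := P.antitoneOn_flux H (yC r hr).1 hx.1 hyx
    rw [Real.dist_eq, sub_zero, abs_of_neg (Zneg r hr), Zeq r hr]
    linarith
  · have := (H.diff_pos _ hx).ne'
    simp only [hZ]
    rw [yφ x ⟨hxI, hx⟩]
    field_simp

/-! ### Local solvability and continuation of profiles -/

/-- Local solvability of the first-order equation satisfied by the flux as a function of
the density. -/
theorem exists_local_flux {ρbar : ℝ} {f D g : ℝ → ℝ} {c ℓ V₀ : ℝ} (H : Coefficients ρbar f D g)
    (hℓ : ℓ ∈ Ioo 0 ρbar) (hV₀ : V₀ + f ℓ - c * ℓ < 0) :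
    ∃ V : ℝ → ℝ, V ℓ = V₀ ∧ ∃ ε > 0, ∀ ρ ∈ Ioo (ℓ - ε) (ℓ + ε), ρ ∈ Ioo 0 ρbar ∧
      V ρ + f ρ - c * ρ < 0 ∧ HasDerivAt V (-(g ρ * D ρ / (V ρ + f ρ - c * ρ))) ρ := by
  -- The denominator starts at `-4m`. Varying `V` by at most `m` and `f - cρ` by at most `m` keeps
  -- it below `-2m`, so the field is bounded by `M/(2m)` and Lipschitz with constant `M/(2m)²`.
  set m := -(V₀ + f ℓ - c * ℓ) / 4 with hm
  have hmpos : 0 < m := by rw [hm]; linarith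
  have hfc : ∀ ρ ∈ Ioo 0 ρbar, ContinuousAt (fun r => f r - c * r) ρ := fun ρ hρ =>
    (H.flux.continuousOn.continuousAt (Icc_mem_nhds hρ.1 hρ.2)).sub
      (continuousAt_const.mul continuousAt_id)
  obtain ⟨M, hM⟩ := isCompact_Icc.exists_bound_of_continuousOn (H.source.mul H.diff)
  have hM0 : 0 ≤ M := (norm_nonneg _).trans (hM ℓ ⟨hℓ.1.le, hℓ.2.le⟩)
  obtain ⟨ε₁, hε₁, hball⟩ := Metric.nhds_basis_closedBall.mem_iff.1
    (inter_mem (isOpen_Ioo.mem_nhds hℓ) ((hfc ℓ hℓ).preimage_mem_nhds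
      (Metric.ball_mem_nhds _ hmpos)))
  rw [Real.closedBall_eq_Icc] at hball
  set ε := min ε₁ (m / (M / (2 * m) + 1)) with hε
  have hεpos : 0 < ε := lt_min hε₁ (by positivity)
  have hsub : Icc (ℓ - ε) (ℓ + ε) ⊆ Icc (ℓ - ε₁) (ℓ + ε₁) :=
    Icc_subset_Icc (by linarith [min_le_left ε₁ (m / (M / (2 * m) + 1))])
      (by linarith [min_le_left ε₁ (m / (M / (2 * m) + 1))])
  have hIoo : ∀ t ∈ Icc (ℓ - ε) (ℓ + ε), t ∈ Ioo 0 ρbar := fun t ht => (hball (hsub ht)).1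
  have hgD : ∀ t ∈ Icc (ℓ - ε) (ℓ + ε), |g t * D t| ≤ M := fun t ht =>
    hM t (Ioo_subset_Icc_self (hIoo t ht))
  have hden : ∀ t ∈ Icc (ℓ - ε) (ℓ + ε), ∀ x ∈ Metric.closedBall V₀ m,
      x + f t - c * t ≤ -(2 * m) := by
    intro t ht x hx
    have h1 := (hball (hsub ht)).2
    rw [mem_preimage, Metric.mem_ball, Real.dist_eq, abs_lt] at h1
    rw [Metric.mem_closedBall, Real.dist_eq, abs_le] at hx
    linarith [h1.2, hx.2]
  -- With the density as independent variable, `D` and `g` need only be continuous: Lipschitz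
  -- dependence is required in `V` alone.
  have PL : IsPicardLindelof (fun t x => -(g t * D t / (x + f t - c * t)))
      (tmin := ℓ - ε) (tmax := ℓ + ε) ⟨ℓ, by linarith, by linarith⟩ V₀
      (.mk m hmpos.le) 0 (.mk (M / (2 * m)) (by positivity))
      (.mk (M / (2 * m * (2 * m))) (by positivity)) := by
    refine ⟨fun t ht => LipschitzOnWith.of_dist_le_mul fun x hx z hz => ?_, fun x hx => ?_,
      fun t ht x hx => ?_, ?_⟩
    · have h1 := hden t ht x hx
      have h2 := hden t ht z hz
      set p := x + f t - c * t with hp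
      set q := z + f t - c * t with hq
      have e : -(g t * D t / p) - -(g t * D t / q) = g t * D t * (x - z) / (p * q) := by
        have : x - z = p - q := by rw [hp, hq]; ring
        rw [this]
        have : p ≠ 0 := by linarith
        have : q ≠ 0 := by linarith
        field_simp
        ring
      rw [Real.dist_eq, Real.dist_eq, e, abs_div, abs_mul, NNReal.coe_mk, div_mul_eq_mul_div]
      have hpq : 2 * m * (2 * m) ≤ |p * q| := by
        rw [abs_mul, abs_of_neg (by linarith), abs_of_neg (by linarith)]
        exact mul_le_mul (by linarith) (by linarith) (by positivity) (by linarith)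
      gcongr
      exact hgD t ht
    · have hs : Icc (ℓ - ε) (ℓ + ε) ⊆ Icc 0 ρbar := fun t ht => Ioo_subset_Icc_self (hIoo t ht)
      refine (((H.source.mono hs).mul (H.diff.mono hs)).div ?_ fun t ht => ?_).neg
      · exact (continuousOn_const.add (H.flux.continuousOn.mono hs)).sub
          (continuousOn_const.mul continuousOn_id)
      · exact (by linarith [hden t ht x hx] : x + f t - c * t < 0).ne
    · have h1 := hden t ht x hx
      rw [Real.norm_eq_abs, abs_neg, abs_div, NNReal.coe_mk]
      have h2 : 2 * m ≤ |x + f t - c * t| := by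
        rw [abs_of_neg (by linarith)]; linarith
      gcongr
      exact hgD t ht
    · simp only [add_sub_cancel_left, sub_sub_cancel, max_self, NNReal.coe_mk, NNReal.coe_zero,
        sub_zero]
      have h1 : ε ≤ m / (M / (2 * m) + 1) := min_le_right _ _
      rw [le_div_iff₀ (by positivity)] at h1
      nlinarith
  obtain ⟨V, hV, hd⟩ := PL.exists_eq_forall_mem_Icc_hasDerivWithinAt₀
  have hdIoo : ∀ t ∈ Ioo (ℓ - ε) (ℓ + ε),
      HasDerivAt V (-(g t * D t / (V t + f t - c * t))) t := fun t ht =>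
    (hd t (Ioo_subset_Icc_self ht)).hasDerivAt (Icc_mem_nhds ht.1 ht.2)
  have hcont : ContinuousAt (fun t => V t + (f t - c * t)) ℓ :=
    (hdIoo ℓ ⟨by linarith, by linarith⟩).continuousAt.add (hfc ℓ hℓ)
  have hev : ∀ᶠ t in 𝓝 ℓ, V t + (f t - c * t) < 0 :=
    hcont.tendsto.eventually_lt_const (by rw [show V ℓ = V₀ from hV]; linarith)
  obtain ⟨ε₂, hε₂, hb₂⟩ := Metric.eventually_nhds_iff_ball.1 hev
  rw [Real.ball_eq_Ioo] at hb₂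
  refine ⟨V, hV, min ε ε₂, lt_min hεpos hε₂, fun ρ hρ => ?_⟩
  have h1 : ρ ∈ Ioo (ℓ - ε) (ℓ + ε) := ⟨by linarith [hρ.1, min_le_left ε ε₂],
    by linarith [hρ.2, min_le_left ε ε₂]⟩
  have h2 : ρ ∈ Ioo (ℓ - ε₂) (ℓ + ε₂) := ⟨by linarith [hρ.1, min_le_right ε ε₂],
    by linarith [hρ.2, min_le_right ε ε₂]⟩
  exact ⟨hIoo ρ (Ioo_subset_Icc_self h1), by linarith [hb₂ ρ h2], hdIoo ρ h1⟩

/-- Local solvability, in both directions, of the profile equation in integrated form, for an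
initial point with negative slope. -/
theorem exists_local_profile {ρbar : ℝ} {f D g : ℝ → ℝ} {c ℓ V₀ ϖ : ℝ}
    (H : Coefficients ρbar f D g) (hℓ : ℓ ∈ Ioo 0 ρbar) (hV₀ : V₀ + f ℓ - c * ℓ < 0) :
    ∃ ψ v : ℝ → ℝ, ψ ϖ = ℓ ∧ v ϖ = V₀ ∧ ∃ ϖ' > ϖ, ∀ t ∈ Ico ϖ ϖ', ψ t ∈ Ioo 0 ρbar ∧
      HasDerivAt ψ ((v t + f (ψ t) - c * ψ t) / D (ψ t)) t ∧ HasDerivAt v (-g (ψ t)) t := by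
  obtain ⟨V, hVℓ, ε, hε, hV⟩ := exists_local_flux H hℓ hV₀
  set C := Ioo (ℓ - ε) (ℓ + ε) with hC
  have hℓC : ℓ ∈ C := ⟨by linarith, by linarith⟩
  have hsub : C ⊆ Icc 0 ρbar := fun t ht => Ioo_subset_Icc_self (hV t ht).1
  set q : ℝ → ℝ := fun r => D r / (V r + f r - c * r) with hq
  have hqneg : ∀ r ∈ C, q r < 0 := fun r hr =>
    div_neg_of_pos_of_neg (H.diff_pos r (hV r hr).1) (hV r hr).2.1
  have hqc : ContinuousOn q C := by
    refine (H.diff.mono hsub).div ?_ fun r hr => (hV r hr).2.1.ne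
    exact (ContinuousOn.add (fun r hr => (hV r hr).2.2.continuousAt.continuousWithinAt)
      (H.flux.continuousOn.mono hsub)).sub (continuousOn_const.mul continuousOn_id)
  -- Position as a function of density; since `Y' = q < 0` it can be inverted to recover the
  -- profile.
  set Y : ℝ → ℝ := fun r => ϖ + ∫ s in ℓ..r, q s with hY
  have hYd : ∀ r ∈ C, HasDerivAt Y (q r) r := fun r hr =>
    (intervalIntegral.integral_hasDerivAt_right
      (hqc.mono (ordConnected_Ioo.uIcc_subset hℓC hr)).intervalIntegrable
      (hqc.stronglyMeasurableAtFilter isOpen_Ioo r hr)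
      (hqc.continuousAt (isOpen_Ioo.mem_nhds hr))).const_add ϖ
  obtain ⟨hanti, ψ, hψ⟩ := exists_leftInverse_hasDerivAt isOpen_Ioo ordConnected_Ioo hYd hqneg hqc
  have hYℓ : Y ℓ = ϖ := by simp [hY]
  have hψϖ : ψ ϖ = ℓ := by rw [← hYℓ]; exact (hψ ℓ hℓC).1
  have hεC : ℓ - ε / 2 ∈ C := ⟨by linarith, by linarith⟩
  refine ⟨ψ, fun t => V (ψ t), hψϖ, (congrArg V hψϖ).trans hVℓ, Y (ℓ - ε / 2), ?_, fun t ht => ?_⟩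
  · rw [gt_iff_lt, ← hYℓ]; exact hanti hεC hℓC (by linarith)
  · obtain ⟨ρ, hρ, rfl⟩ : t ∈ Y '' Ioc (ℓ - ε / 2) ℓ :=
      intermediate_value_Ioc' (by linarith)
        (fun s hs => (hYd s ⟨by linarith [hs.1], by linarith [hs.2]⟩).continuousAt.continuousWithinAt)
        (by rwa [hYℓ])
    have hρC : ρ ∈ C := ⟨by linarith [hρ.1], by linarith [hρ.2]⟩
    obtain ⟨h1, h2⟩ := hψ ρ hρC
    obtain ⟨h3, h4, h5⟩ := hV ρ hρC
    rw [h1]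
    have hDne := (H.diff_pos ρ h3).ne'
    have hZne := h4.ne
    refine ⟨h3, h2.congr_deriv (by simp only [hq, inv_div, h1]), ?_⟩
    have h6 : HasDerivAt V (-(g ρ * D ρ / (V ρ + f ρ - c * ρ))) (ψ (Y ρ)) := by rwa [h1]
    refine (h6.comp (Y ρ) h2).congr_deriv ?_
    simp only [hq, inv_div]
    field_simp

/-- A decreasing profile on a half-line that stays away from `0` can be extended. -/
theorem FluxProfile.exists_extension {ρbar : ℝ} {f D g : ℝ → ℝ} {c ϖ : ℝ} {φ v : ℝ → ℝ}
    (H : Coefficients ρbar f D g) (P : FluxProfile ρbar f D g c (Iio ϖ) φ v) {p ρ₀ : ℝ}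
    (hp : p < ϖ) (hφp : φ p < ρbar) (hρ₀ : 0 < ρ₀) (hlow : ∀ t < ϖ, ρ₀ ≤ φ t) :
    ∃ ϖ' > ϖ, ∃ φ' v' : ℝ → ℝ, FluxProfile ρbar f D g c (Iio ϖ') φ' v' ∧
      EqOn φ' φ (Iio ϖ) ∧ EqOn v' v (Iio ϖ) ∧ ∀ t ∈ Ico p ϖ', φ' t ∈ Ioo 0 ρbar := by
  have hactive : ∀ t ∈ Ico p ϖ, t ∈ Iio ϖ ∩ φ ⁻¹' Ioo 0 ρbar := fun t ht =>
    ⟨ht.2, hρ₀.trans_le (hlow t ht.2), (P.antitoneOn H hp ht.2 ht.1).trans_lt hφp⟩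
  have hbdd : BddBelow (φ '' Iio ϖ) := ⟨ρ₀, by rintro _ ⟨t, ht, rfl⟩; exact hlow t ht⟩
  obtain ⟨ℓ, hℓlim⟩ : ∃ ℓ, Tendsto φ (𝓝[<] ϖ) (𝓝 ℓ) := ⟨_, (P.antitoneOn H).tendsto_nhdsLT hbdd⟩
  have hpev : ∀ᶠ t in 𝓝[<] ϖ, t ∈ Ico p ϖ := Ico_mem_nhdsLT hp
  have hℓ : ℓ ∈ Ioo 0 ρbar := by
    refine ⟨hρ₀.trans_le (ge_of_tendsto hℓlim ?_), (le_of_tendsto hℓlim ?_).trans_lt hφp⟩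
    · filter_upwards [self_mem_nhdsWithin] with t ht using hlow t ht
    · filter_upwards [hpev] with t ht using P.antitoneOn H hp ht.2 ht.1
  have hℓcc : ℓ ∈ Icc 0 ρbar := Ioo_subset_Icc_self hℓ
  -- Freezing `φ` at its limit `ℓ` beyond `ϖ` makes the flux meaningful at `ϖ` itself, and so
  -- provides the initial data for the continuation.
  set φ₁ : ℝ → ℝ := fun t => if t < ϖ then φ t else ℓ with hφ₁
  have hφ₁lt : ∀ t < ϖ, φ₁ t = φ t := fun t ht => if_pos ht
  have hφ₁ge : ∀ t, ϖ ≤ t → φ₁ t = ℓ := fun t ht => if_neg (not_lt.2 ht)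
  have hφ₁m : ∀ t, φ₁ t ∈ Icc 0 ρbar := fun t => by
    rcases lt_or_ge t ϖ with h | h
    · rw [hφ₁lt t h]; exact P.mapsTo h
    · rw [hφ₁ge t h]; exact hℓcc
  have hφ₁c : Continuous φ₁ := by
    rw [continuous_iff_continuousAt]
    intro t
    rcases lt_trichotomy t ϖ with h | rfl | h
    · refine (P.continuousOn.continuousAt (Iio_mem_nhds h)).congr ?_
      filter_upwards [Iio_mem_nhds h] with s hs using (hφ₁lt s hs).symm
    · rw [continuousAt_iff_continuous_left'_right', ContinuousWithinAt, ContinuousWithinAt,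
        hφ₁ge t le_rfl]
      refine ⟨hℓlim.congr' ?_, tendsto_const_nhds.congr' ?_⟩
      · filter_upwards [self_mem_nhdsWithin] with s hs using (hφ₁lt s hs).symm
      · filter_upwards [self_mem_nhdsWithin] with s hs using (hφ₁ge s (le_of_lt hs)).symm
    · refine (continuousAt_const (y := ℓ)).congr ?_
      filter_upwards [Ioi_mem_nhds h] with s hs using (hφ₁ge s (le_of_lt hs)).symm
  have hgc : Continuous fun t => g (φ₁ t) := H.source.comp_continuous hφ₁c hφ₁m
  set v₁ : ℝ → ℝ := fun t => v p - ∫ s in p..t, g (φ₁ s) with hv₁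
  have hv₁d : ∀ t, HasDerivAt v₁ (-g (φ₁ t)) t := fun t =>
    (intervalIntegral.integral_hasDerivAt_right (hgc.intervalIntegrable _ _)
      (hgc.stronglyMeasurableAtFilter _ _) hgc.continuousAt).const_sub (v p)
  have hv₁eq : EqOn v₁ v (Iio ϖ) := by
    refine isOpen_Iio.eqOn_of_deriv_eq isPreconnected_Iio
      (fun t _ => (hv₁d t).differentiableAt.differentiableWithinAt)
      (fun t ht => (P.hasDerivAt_flux t ht).differentiableAt.differentiableWithinAt)
      (fun t ht => ?_) hp (by simp [hv₁])
    rw [(hv₁d t).deriv, (P.hasDerivAt_flux t ht).deriv, hφ₁lt t ht]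
  have hfc : Continuous fun t => f (φ₁ t) := H.flux.continuousOn.comp_continuous hφ₁c hφ₁m
  have hDc : Continuous fun t => D (φ₁ t) := H.diff.comp_continuous hφ₁c hφ₁m
  have hvc : Continuous v₁ := continuous_iff_continuousAt.2 fun t => (hv₁d t).continuousAt
  set u : ℝ → ℝ := fun t => v₁ t + f (φ₁ t) - c * φ₁ t with hu
  have huc : Continuous u := (hvc.add hfc).sub (continuous_const.mul hφ₁c)
  have hu_eq : ∀ t ∈ Ico p ϖ, u t = D (φ t) * deriv φ t := fun t ht => by
    rw [P.flux_eq t ht.2 (hactive t ht).2]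
    simp only [hu, hφ₁lt t ht.2, hv₁eq ht.2]
  have hu_neg : ∀ t ∈ Ico p ϖ, u t < 0 := fun t ht => by
    rw [hu_eq t ht]
    exact mul_neg_of_pos_of_neg (H.diff_pos _ (hactive t ht).2) (P.deriv_neg H (hactive t ht))
  have hDℓ := H.diff_pos ℓ hℓ
  have hleft : HasDerivWithinAt φ₁ (u ϖ / D ℓ) (Iic ϖ) ϖ := by
    refine hasDerivWithinAt_Iic_of_tendsto_deriv (s := Ioo p ϖ) (fun t ht => ?_)
      hφ₁c.continuousAt.continuousWithinAt (Ioo_mem_nhdsLT hp) ?_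
    · have := P.differentiableAt t ht.2 (hactive t ⟨ht.1.le, ht.2⟩).2
      refine (this.congr_of_eventuallyEq ?_).differentiableWithinAt
      filter_upwards [Iio_mem_nhds ht.2] with s hs using hφ₁lt s hs
    · have h1 : Tendsto (fun t => u t / D (φ₁ t)) (𝓝[<] ϖ) (𝓝 (u ϖ / D (φ₁ ϖ))) :=
        ((huc.continuousAt).div hDc.continuousAt
          (by rw [hφ₁ge ϖ le_rfl]; exact hDℓ.ne')).tendsto.mono_left nhdsWithin_le_nhds
      rw [hφ₁ge ϖ le_rfl] at h1
      refine h1.congr' ?_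
      filter_upwards [hpev] with t ht
      have : deriv φ₁ t = deriv φ t := EventuallyEq.deriv_eq (by
        filter_upwards [Iio_mem_nhds ht.2] with s hs using hφ₁lt s hs)
      rw [this, hu_eq t ht, hφ₁lt t ht.2]
      have := (H.diff_pos _ (hactive t ht).2).ne'
      field_simp
  have hu_le : u ϖ ≤ 0 := le_of_tendsto (huc.continuousAt.tendsto.mono_left nhdsWithin_le_nhds)
    (by filter_upwards [hpev] with t ht using (hu_neg t ht).le)
  -- The slope cannot degenerate at `ϖ`: if `u ϖ = 0`, the left derivative of `φ₁` vanishes and that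
  -- of `u` is `-g ℓ < 0`, whereas `u < 0 = u ϖ` on the left requires it to be nonnegative.
  have hu_lt : u ϖ < 0 := by
    refine lt_of_le_of_ne hu_le fun h0 => ?_
    rw [h0, zero_div] at hleft
    have hn : Icc 0 ρbar ∈ 𝓝 (φ₁ ϖ) := by
      rw [hφ₁ge ϖ le_rfl]; exact Icc_mem_nhds hℓ.1 hℓ.2
    have hf : HasDerivAt f (derivWithin f (Icc 0 ρbar) (φ₁ ϖ)) (φ₁ ϖ) :=
      (((H.flux.differentiableOn (by simp)) _ (mem_of_mem_nhds hn)).hasDerivWithinAt).hasDerivAt hn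
    have hd : HasDerivWithinAt u (-g ℓ) (Iic ϖ) ϖ := by
      refine (((hv₁d ϖ).hasDerivWithinAt.fun_add (hf.comp_hasDerivWithinAt ϖ hleft)).fun_sub
        (hleft.const_mul c)).congr_deriv ?_
      rw [hφ₁ge ϖ le_rfl]; ring
    have := deriv_nonneg_of_eventually_left (hd.mono Iio_subset_Iic_self) (by
      filter_upwards [hpev] with t ht
      rw [h0]; exact (hu_neg t ht).le)
    linarith [H.source_pos ℓ hℓ]
  have hu_ϖ : u ϖ = v₁ ϖ + f ℓ - c * ℓ := by simp only [hu, hφ₁ge ϖ le_rfl]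
  obtain ⟨ψ, w, hψϖ, hwϖ, ϖ', hϖ', hloc⟩ := exists_local_profile (ϖ := ϖ) H hℓ
    (V₀ := v₁ ϖ) (c := c) (by rw [← hu_ϖ]; exact hu_lt)
  set φ' : ℝ → ℝ := fun t => if t < ϖ then φ t else ψ t with hφ'
  set v' : ℝ → ℝ := fun t => if t < ϖ then v t else w t with hv'
  have e1 : ∀ t < ϖ, φ' t = φ t := fun t ht => if_pos ht
  have e2 : ∀ t, ϖ ≤ t → φ' t = ψ t := fun t ht => if_neg (not_lt.2 ht)
  have e3 : ∀ t < ϖ, v' t = v t := fun t ht => if_pos ht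
  have e4 : ∀ t, ϖ ≤ t → v' t = w t := fun t ht => if_neg (not_lt.2 ht)
  have n1 : ∀ t < ϖ, φ' =ᶠ[𝓝 t] φ := fun t ht => by
    filter_upwards [Iio_mem_nhds ht] with s hs using e1 s hs
  have n3 : ∀ t < ϖ, v' =ᶠ[𝓝 t] v := fun t ht => by
    filter_upwards [Iio_mem_nhds ht] with s hs using e3 s hs
  have glue : ∀ {a b q : ℝ → ℝ} {d : ℝ}, HasDerivWithinAt a d (Iic ϖ) ϖ → HasDerivAt b d ϖ →
      (∀ t ≤ ϖ, q t = a t) → (∀ t ≥ ϖ, q t = b t) → HasDerivAt q d ϖ := by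
    intro a b q d ha hb hqa hqb
    have h1 : HasDerivWithinAt q d (Iic ϖ) ϖ := ha.congr hqa (hqa ϖ le_rfl)
    have h2 : HasDerivWithinAt q d (Ici ϖ) ϖ := hb.hasDerivWithinAt.congr hqb (hqb ϖ le_rfl)
    have := h1.union h2
    rwa [Iic_union_Ici, hasDerivWithinAt_univ] at this
  have hright : ∀ t ∈ Ico ϖ ϖ', φ' t ∈ Ioo 0 ρbar ∧
      HasDerivAt φ' ((v' t + f (φ' t) - c * φ' t) / D (φ' t)) t ∧ HasDerivAt v' (-g (φ' t)) t := by
    intro t ht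
    obtain ⟨h1, h2, h3⟩ := hloc t ht
    rw [e2 t ht.1, e4 t ht.1]
    refine ⟨h1, ?_⟩
    rcases ht.1.eq_or_lt with rfl | hlt
    · rw [hψϖ, hwϖ, ← hu_ϖ] at h2
      rw [hψϖ] at h3
      rw [hψϖ, hwϖ, ← hu_ϖ]
      constructor
      · refine glue hleft h2 (fun t ht => ?_) e2
        rcases ht.eq_or_lt with rfl | h
        · rw [e2 t le_rfl, hψϖ, hφ₁ge t le_rfl]
        · rw [e1 t h, hφ₁lt t h]
      · have := (hv₁d ϖ).hasDerivWithinAt (s := Iic ϖ)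
        rw [hφ₁ge ϖ le_rfl] at this
        refine glue this h3 (fun t ht => ?_) e4
        rcases ht.eq_or_lt with rfl | h
        · rw [e4 t le_rfl, hwϖ]
        · rw [e3 t h, hv₁eq h]
    · refine ⟨h2.congr_of_eventuallyEq ?_, h3.congr_of_eventuallyEq ?_⟩
      · filter_upwards [Ioi_mem_nhds hlt] with s hs using e2 s (le_of_lt hs)
      · filter_upwards [Ioi_mem_nhds hlt] with s hs using e4 s (le_of_lt hs)
  refine ⟨ϖ', hϖ', φ', v', ⟨isOpen_Iio, isLowerSet_Iio ϖ', nonempty_Iio, fun t ht => ?_,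
    fun t ht => ?_, fun t ht => ?_, fun t ht h => ?_, fun t ht h => ?_, fun t ht h => ?_, ?_⟩,
    e1, e3, fun t ht => ?_⟩
  · rcases lt_or_ge t ϖ with h | h
    · rw [e1 t h]; exact P.mapsTo h
    · exact Ioo_subset_Icc_self (hright t ⟨h, ht⟩).1
  · rcases lt_or_ge t ϖ with h | h
    · exact ((P.continuousOn.continuousAt (Iio_mem_nhds h)).congr (n1 t h).symm).continuousWithinAt
    · exact (hright t ⟨h, ht⟩).2.1.continuousAt.continuousWithinAt
  · rcases lt_or_ge t ϖ with h' | h'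
    · rw [e1 t h']; exact (P.hasDerivAt_flux t h').congr_of_eventuallyEq (n3 t h')
    · exact (hright t ⟨h', ht⟩).2.2
  · rcases lt_or_ge t ϖ with h' | h'
    · rw [e1 t h'] at h
      exact (P.differentiableAt t h' h).congr_of_eventuallyEq (n1 t h')
    · exact (hright t ⟨h', ht⟩).2.1.differentiableAt
  · rcases lt_or_ge t ϖ with h' | h'
    · rw [e1 t h'] at h ⊢
      rw [(n1 t h').deriv_eq, e3 t h']
      exact P.flux_eq t h' h
    · obtain ⟨h1, h2, -⟩ := hright t ⟨h', ht⟩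
      rw [h2.deriv, mul_div_cancel₀ _ (H.diff_pos _ h1).ne']
  · rcases lt_or_ge t ϖ with h' | h'
    · rw [e3 t h']
      refine P.flux_eq_right t h' ?_
      filter_upwards [h, n1 t h'] with s hs1 hs2
      rw [← hs2, hs1]
    · exact absurd h.self_of_nhds (hright t ⟨h', ht⟩).1.2.ne
  · refine P.tendsto.congr' ?_
    filter_upwards [eventually_lt_atBot ϖ] with t ht using (e1 t ht).symm
  · rcases lt_or_ge t ϖ with h' | h'
    · rw [e1 t h']; exact (hactive t ⟨ht.1, h'⟩).2
    · exact (hright t ⟨h', ht.2⟩).1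

/-- An extension in the sense of integrated profiles is a semi-wavefront profile. -/
theorem IsSemiWavefrontFrom.of_fluxProfile {ρbar : ℝ} {f D g : ℝ → ℝ} {c ϖ ϖ' p : ℝ}
    {φ φ' v' : ℝ → ℝ} (H : Coefficients ρbar f D g)
    (hφ : IsSemiWavefrontFrom ρbar f D g c ρbar ϖ φ) (hlt : ϖ < ϖ') (hp : p < ϖ)
    (P : FluxProfile ρbar f D g c (Iio ϖ') φ' v') (heq : EqOn φ' φ (Iio ϖ))
    (hae : ∀ᵐ ξ ∂(volume.restrict (Iio ϖ)),
      D (φ ξ) * deriv φ ξ - f (φ ξ) + c * φ ξ = v' ξ)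
    (hactive : ∀ t ∈ Ico p ϖ', φ' t ∈ Ioo 0 ρbar) :
    IsSemiWavefrontFrom ρbar f D g c ρbar ϖ' φ' := by
  have n1 : ∀ t < ϖ, φ' =ᶠ[𝓝 t] φ := fun t ht => by
    filter_upwards [Iio_mem_nhds ht] with s hs using heq hs
  have hact : ∀ t, p ≤ t → t < ϖ' → t ∈ Iio ϖ' ∩ φ' ⁻¹' Ioo 0 ρbar := fun t h1 h2 =>
    ⟨h2, hactive t ⟨h1, h2⟩⟩
  -- Once the flux identity holds almost everywhere on the longer half-line, the weak equation there
  -- is an integration by parts.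
  have hae' : ∀ᵐ ξ ∂(volume.restrict (Iio ϖ')),
      D (φ' ξ) * deriv φ' ξ - f (φ' ξ) + c * φ' ξ = v' ξ := by
    rw [ae_restrict_iff' measurableSet_Iio] at hae ⊢
    filter_upwards [hae] with t ht ht'
    rcases lt_or_ge t ϖ with h | h
    · rw [heq h, (n1 t h).deriv_eq]; exact ht h
    · rw [P.flux_eq t ht' (hact t (hp.le.trans h) ht').2]; ring
  have vc : ContinuousOn v' (Iio ϖ') := fun x hx =>
    (P.hasDerivAt_flux x hx).continuousAt.continuousWithinAt
  have fc : ContinuousOn (fun t => f (φ' t)) (Iio ϖ') :=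
    H.flux.continuousOn.comp P.continuousOn P.mapsTo
  have gc : ContinuousOn (fun t => g (φ' t)) (Iio ϖ') := H.source.comp P.continuousOn P.mapsTo
  have uloc : LocallyIntegrableOn (fun t => v' t + f (φ' t) - c * φ' t) (Iio ϖ') :=
    ((vc.add fc).sub (continuousOn_const.mul P.continuousOn)).locallyIntegrableOn measurableSet_Iio
  have hTW : IsTravelingWave ρbar f D g c (Iio ϖ') φ' := by
    refine ⟨isOpen_Iio, ordConnected_Iio, P.mapsTo, P.continuousOn, ?_, fun x hx => ?_,
      fun ψ ψs ψc ψI => ?_⟩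
    · have := hφ.travelingWave.ae_differentiableAt
      rw [ae_restrict_iff' measurableSet_Iio] at this ⊢
      filter_upwards [this] with t ht ht'
      rcases lt_or_ge t ϖ with h | h
      · exact (ht h).congr_of_eventuallyEq (n1 t h)
      · exact P.differentiableAt t ht' (hact t (hp.le.trans h) ht').2
    · obtain ⟨s, hs, hi⟩ := uloc x hx
      refine ⟨s ∩ Iio ϖ', inter_mem hs self_mem_nhdsWithin, ?_⟩
      refine (hi.mono_set inter_subset_left).congr_fun_ae ?_
      filter_upwards [ae_restrict_of_ae_restrict_of_subset inter_subset_right hae'] with t ht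
      linarith
    · rw [← (integral_mul_deriv_add_eq_zero (q := fun t => -g (φ' t)) P.hasDerivAt_flux gc.neg
        ψs ψc ψI).2.2]
      refine integral_congr_ae ?_
      filter_upwards [hae'] with t ht
      rw [← ht]; ring
  obtain ⟨S, hSf, hSI, hS, hcl⟩ := hφ.classicalOrSharp
  have hcases : ∀ t ∈ Iio ϖ' \ S, t < ϖ → t ∈ Iio ϖ \ S := fun t ht h => ⟨h, ht.2⟩
  have hDeq : ∀ t < ϖ, D (φ' t) * deriv φ' t = D (φ t) * deriv φ t := fun t ht => by
    rw [heq ht, (n1 t ht).deriv_eq]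
  have hu : ∀ t ∈ Iio ϖ' ∩ φ' ⁻¹' Ioo 0 ρbar,
      HasDerivAt (fun ξ => D (φ' ξ) * deriv φ' ξ)
        (-((c - h ρbar f (φ' t)) * deriv φ' t + g (φ' t))) t := fun t ht => by
    refine (P.hasDerivAt_flux_active H ht).congr_of_eventuallyEq ?_
    filter_upwards [P.isOpen_active.mem_nhds ht] with s hs using P.flux_eq s hs.1 hs.2
  have hAC : ∀ a b, p ≤ a → a ≤ b → b < ϖ' →
      AbsolutelyContinuousOnInterval (fun ξ => D (φ' ξ) * deriv φ' ξ) a b := by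
    intro a b hpa hab hb
    have hm : ∀ t ∈ Icc a b, t ∈ Iio ϖ' ∩ φ' ⁻¹' Ioo 0 ρbar := fun t ht =>
      hact t (hpa.trans ht.1) (ht.2.trans_lt hb)
    have fv : ContDiffOn ℝ 1 (fun t => v' t + f (φ' t) - c * φ' t)
        (Iio ϖ' ∩ φ' ⁻¹' Ioo 0 ρbar) := by
      have h1 : ContDiffOn ℝ 1 v' (Iio ϖ' ∩ φ' ⁻¹' Ioo 0 ρbar) := by
        rw [show (1 : WithTop ℕ∞) = 0 + 1 from rfl,
          contDiffOn_succ_iff_deriv_of_isOpen P.isOpen_active]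
        refine ⟨fun x hx => (P.hasDerivAt_flux x hx.1).differentiableAt.differentiableWithinAt,
          by simp, contDiffOn_zero.2 ?_⟩
        exact (gc.mono inter_subset_left).neg.congr fun x hx => (P.hasDerivAt_flux x hx.1).deriv
      exact (h1.add (H.flux.comp (P.contDiffOn H) fun x hx => P.mapsTo hx.1)).sub
        (contDiffOn_const.mul (P.contDiffOn H))
    refine ContDiffOn.absolutelyContinuousOnInterval ?_
    rw [uIcc_of_le hab]
    exact (fv.mono hm).congr fun t ht => P.flux_eq t (hm t ht).1 (hm t ht).2
  refine ⟨hTW, ⟨S, hSf, hSI.trans (Iio_subset_Iio hlt.le), fun ξ hξ => ?_, fun ξ hξ => ?_,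
    fun a b hab hsub => ?_, ?_⟩, hφ.mem, hφ.source_eq_zero, Or.inr (P.antitoneOn H), ?_, P.tendsto⟩
  · have hlt' : ξ < ϖ := hSI hξ
    rw [heq hlt']
    refine ⟨(hS ξ hξ).1, fun hd => (hS ξ hξ).2 (hd.congr_of_eventuallyEq (n1 ξ hlt').symm)⟩
  · rcases lt_or_ge ξ ϖ with h | h
    · exact (hcl.differentiableAt ξ (hcases ξ hξ h)).congr_of_eventuallyEq (n1 ξ h)
    · have := hact ξ (hp.le.trans h) hξ.1
      exact P.differentiableAt ξ this.1 this.2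
  · have old : ∀ s, a ≤ s → s ≤ b → s < ϖ →
        AbsolutelyContinuousOnInterval (fun ξ => D (φ' ξ) * deriv φ' ξ) a s := by
      intro s has hsb hs
      have hss : Icc a s ⊆ Iio ϖ \ S := fun t ht =>
        ⟨ht.2.trans_lt hs, (hsub ⟨ht.1, ht.2.trans hsb⟩).2⟩
      have := hcl.absolutelyContinuous a s has hss
      rw [absolutelyContinuousOnInterval_iff] at this ⊢
      intro ε hε
      obtain ⟨δ, hδ, hh⟩ := this ε hε
      refine ⟨δ, hδ, fun E hE hEδ => ?_⟩
      convert hh E hE hEδ using 1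
      refine Finset.sum_congr rfl fun i hi => ?_
      have := hE.1 i hi
      rw [uIcc_of_le has] at this
      rw [hDeq _ (this.1.2.trans_lt hs), hDeq _ (this.2.2.trans_lt hs)]
    have hb : b < ϖ' := (hsub (right_mem_Icc.2 hab)).1
    -- The pieces are joined at `p < ϖ`: the old absolute continuity reaches only points strictly
    -- before `ϖ`, while from `p` on the flux is `C¹`, across `ϖ` included.
    rcases le_total b p with hbp | hpb
    · exact old b hab le_rfl (hbp.trans_lt hp)
    · rcases le_total a p with hap | hpa
      · exact absolutelyContinuousOnInterval_trans hap hpb (old p hap hpb hp)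
          (hAC p b le_rfl hpb hb)
      · exact hAC a b hpa hab hb
  · have hold := hcl.equation
    have hm : MeasurableSet S := hSf.measurableSet
    rw [ae_restrict_iff' (measurableSet_Iio.diff hm)] at hold ⊢
    filter_upwards [hold] with t ht ht'
    rcases lt_or_ge t ϖ with h' | h'
    · rw [heq h', (n1 t h').deriv_eq]
      refine (ht (hcases t ht' h')).congr_of_eventuallyEq ?_
      filter_upwards [Iio_mem_nhds h'] with s hs using hDeq s hs
    · exact hu t (hact t (hp.le.trans h') ht'.1)
  · obtain ⟨a, ha, b, hb, hne⟩ := hφ.nonconstant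
    refine ⟨a, lt_trans ha hlt, b, lt_trans hb hlt, ?_⟩
    rwa [heq ha, heq hb]

/-! ### The range of the profiles -/

/-- A maximal semi-wavefront profile from `ρbar` takes all the values between `0` and `ρbar`. -/
theorem IsMaximalSemiWavefrontFrom.exists_fluxProfile {ρbar : ℝ} {f D g : ℝ → ℝ} {c ϖ : ℝ}
    {φ : ℝ → ℝ} (H : Coefficients ρbar f D g)
    (hφ : IsMaximalSemiWavefrontFrom ρbar f D g c ρbar ϖ φ) {p : ℝ} (hp : p < ϖ)
    (hφp : φ p < ρbar) :
    ∃ v : ℝ → ℝ, FluxProfile ρbar f D g c (Iio ϖ) φ v ∧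
      ∀ ρ ∈ Ioo 0 ρbar, ∃ x ∈ Iio ϖ, φ x = ρ := by
  obtain ⟨S, hSf, hSI, hS, hcl⟩ := hφ.1.classicalOrSharp
  obtain ⟨v, hv, hae, heq⟩ := hφ.1.travelingWave.exists_flux H ⟨p, hp⟩ hSf hcl
  have P := FluxProfile.of_travelingWave H hφ.1.travelingWave ⟨p, hp⟩ (isLowerSet_Iio ϖ) hS hcl
    hφ.1.tendsto hv heq
  refine ⟨v, P, fun ρ hρ => ?_⟩
  obtain ⟨a, ha1, ha2⟩ :=
    ((P.tendsto.eventually_const_lt hρ.2).and (eventually_lt_atBot ϖ)).exists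
  obtain ⟨b, hb, hbρ⟩ : ∃ b ∈ Iio ϖ, φ b < ρ := by
    -- Without a value below `ρ` the profile stays above `ρ > 0` and continues past `ϖ`, which
    -- contradicts maximality.
    by_contra! hno
    obtain ⟨ϖ', hϖ', φ', v', P', e1, e2, hact⟩ := P.exists_extension H hp hφp hρ.1 hno
    refine hφ.2 ϖ' hϖ' ⟨φ', hφ.1.of_fluxProfile H hϖ' hp P' e1 ?_ hact, e1⟩
    rw [ae_restrict_iff' measurableSet_Iio] at hae ⊢
    filter_upwards [hae] with t ht ht'
    rw [ht ht', e2 ht']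
  obtain ⟨x, hx, hxρ⟩ := isPreconnected_Iio.intermediate_value hb ha2 P.continuousOn ⟨hbρ.le, ha1.le⟩
  exact ⟨x, hx, hxρ⟩

/-- A wavefront profile takes all the values between `0` and `ρbar`. -/
theorem IsWavefront.exists_fluxProfile {ρbar : ℝ} {f D g : ℝ → ℝ} {c : ℝ} {φ : ℝ → ℝ}
    (H : Coefficients ρbar f D g) (hφ : IsWavefront ρbar f D g c ρbar 0 φ) :
    ∃ v : ℝ → ℝ, FluxProfile ρbar f D g c univ φ v ∧
      ∀ ρ ∈ Ioo 0 ρbar, ∃ x ∈ univ, φ x = ρ := by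
  obtain ⟨S, hSf, hSI, hS, hcl⟩ := hφ.classicalOrSharp
  obtain ⟨v, hv, -, heq⟩ := hφ.travelingWave.exists_flux H univ_nonempty hSf hcl
  have P := FluxProfile.of_travelingWave H hφ.travelingWave univ_nonempty isLowerSet_univ hS hcl
    hφ.tendsto_atBot hv heq
  refine ⟨v, P, fun ρ hρ => ?_⟩
  obtain ⟨a, ha⟩ := (hφ.tendsto_atBot.eventually_const_lt hρ.2).exists
  obtain ⟨b, hb⟩ := (hφ.tendsto_atTop.eventually_lt_const hρ.1).exists
  exact isPreconnected_univ.intermediate_value (mem_univ b) (mem_univ a) P.continuousOn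
    ⟨hb.le, ha.le⟩

/-! ### Comparison and convergence in the phase plane -/

namespace PhaseTrajectory

variable {ρbar : ℝ} {f D g₁ g₂ : ℝ → ℝ} {c : ℝ} {y₁ Z₁ y₂ Z₂ : ℝ → ℝ}

/-- Both trajectories share `f` and `c`, which therefore cancel: only the source terms drive the
difference. -/
theorem hasDerivAt_sub (T₁ : PhaseTrajectory ρbar f D g₁ c y₁ Z₁)
    (T₂ : PhaseTrajectory ρbar f D g₂ c y₂ Z₂) {ρ : ℝ} (hρ : ρ ∈ Ioo 0 ρbar) :
    HasDerivAt (fun r => Z₁ r - Z₂ r) (D ρ * (g₂ ρ / Z₂ ρ - g₁ ρ / Z₁ ρ)) ρ := by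
  have := (T₁.hasDerivAt ρ hρ).fun_sub (T₂.hasDerivAt ρ hρ)
  refine (this.congr_of_eventuallyEq (Eventually.of_forall fun r => ?_)).congr_deriv (by ring)
  ring

/-- Comparison in the phase plane: a larger source term gives a steeper profile. -/
theorem le_of_source_le (hD : ∀ ρ ∈ Ioo 0 ρbar, 0 < D ρ) (hg₂ : ∀ ρ ∈ Ioo 0 ρbar, 0 < g₂ ρ)
    (hg : ∀ ρ ∈ Ioo 0 ρbar, g₂ ρ ≤ g₁ ρ) (T₁ : PhaseTrajectory ρbar f D g₁ c y₁ Z₁)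
    (T₂ : PhaseTrajectory ρbar f D g₂ c y₂ Z₂) {ρ : ℝ} (hρ : ρ ∈ Ioo 0 ρbar) : Z₁ ρ ≤ Z₂ ρ := by
  by_contra! hlt
  set w : ℝ → ℝ := fun r => Z₁ r - Z₂ r with hw
  have hwρ : 0 < w ρ := sub_pos.2 hlt
  have hlim : Tendsto w (𝓝[<] ρbar) (𝓝 0) := by simpa using T₁.tendsto.sub T₂.tendsto
  obtain ⟨b, hb, hbI⟩ := ((hlim.eventually_lt_const hwρ).and (Ioo_mem_nhdsLT hρ.2)).exists
  have hmem : ∀ x ∈ Icc ρ b, x ∈ Ioo 0 ρbar := fun x hx =>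
    ⟨hρ.1.trans_le hx.1, hx.2.trans_lt hbI.2⟩
  have hd : ∀ x ∈ Icc ρ b, HasDerivAt w (D x * (g₂ x / Z₂ x - g₁ x / Z₁ x)) x := fun x hx =>
    T₁.hasDerivAt_sub T₂ (hmem x hx)
  -- The constant `w ρ > 0` is a barrier: wherever `w` equals it, `Z₂ < Z₁ < 0` and `g₂ ≤ g₁` give
  -- `w' > 0`. So `w` cannot fall below it, although it must in order to tend to `0`.
  have := image_le_of_deriv_right_lt_deriv_boundary' (f := fun _ => w ρ) (f' := fun _ => 0)
    (B := w) (a := ρ) (b := b) (B' := fun x => D x * (g₂ x / Z₂ x - g₁ x / Z₁ x))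
    continuousOn_const (fun x _ => hasDerivWithinAt_const _ _ _) le_rfl
    (fun x hx => (hd x hx).continuousAt.continuousWithinAt)
    (fun x hx => (hd x (Ico_subset_Icc_self hx)).hasDerivWithinAt) (fun x hx he => by
      have hx' := hmem x (Ico_subset_Icc_self hx)
      refine mul_pos (hD x hx') (sub_pos.2 ?_)
      have h1 := T₁.neg x hx'
      have h2 := T₂.neg x hx'
      have h3 : Z₂ x < Z₁ x := by
        have : 0 < Z₁ x - Z₂ x := by rw [show Z₁ x - Z₂ x = w x from rfl, ← he]; exact hwρ
        linarith
      have h4 := hg₂ x hx'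
      have h5 := hg x hx'
      rw [← neg_lt_neg_iff, ← div_neg, ← div_neg]
      exact (div_lt_div_of_pos_left h4 (by linarith) (by linarith)).trans_le
        (div_le_div_of_nonneg_right h5 (by linarith))) (right_mem_Icc.2 hbI.1.le)
  exact absurd hb (not_lt.2 this)

/-- Quantitative stability in the phase plane. -/
theorem sub_le_of_source_le {ε : ℝ} (hD : ∀ ρ ∈ Ioo 0 ρbar, 0 < D ρ)
    (hg₂ : ∀ ρ ∈ Ioo 0 ρbar, 0 < g₂ ρ)
    (hg : ∀ ρ ∈ Ioo 0 ρbar, g₂ ρ ≤ g₁ ρ) (hε : ∀ ρ ∈ Ioo 0 ρbar, g₁ ρ ≤ g₂ ρ + ε)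
    (T₁ : PhaseTrajectory ρbar f D g₁ c y₁ Z₁)
    (T₂ : PhaseTrajectory ρbar f D g₂ c y₂ Z₂) {ρ r : ℝ} (hρ : 0 < ρ) (hρr : ρ ≤ r)
    (hr : r < ρbar) :
    Z₂ ρ - Z₁ ρ ≤ Z₂ r - Z₁ r + ε * (y₂ ρ - y₂ r) := by
  have hmem : ∀ x ∈ Icc ρ r, x ∈ Ioo 0 ρbar := fun x hx =>
    ⟨hρ.trans_le hx.1, hx.2.trans_lt hr⟩
  have hd : ∀ x ∈ Icc ρ r, HasDerivAt (fun x => Z₂ x - Z₁ x - ε * y₂ x)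
      (D x * (g₁ x / Z₁ x - g₂ x / Z₂ x) - ε * (D x / Z₂ x)) x := fun x hx =>
    (T₂.hasDerivAt_sub T₁ (hmem x hx)).fun_sub ((T₂.hasDerivAt_inverse x (hmem x hx)).const_mul ε)
  -- The term `ε y₂` has derivative `ε D/Z₂`, exactly what turns `g₂` into `g₂ + ε`. The sign then
  -- follows from `g₁ ≤ g₂ + ε` and `|Z₂| ≤ |Z₁|`, with no Lipschitz bound near `ρbar`.
  have hmono : MonotoneOn (fun x => Z₂ x - Z₁ x - ε * y₂ x) (Icc ρ r) := by
    refine monotoneOn_of_deriv_nonneg (convex_Icc ρ r)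
      (fun x hx => (hd x hx).continuousAt.continuousWithinAt)
      (fun x hx => (hd x (interior_subset hx)).differentiableAt.differentiableWithinAt)
      fun x hx => ?_
    have hx' := hmem x (interior_subset hx)
    rw [(hd x (interior_subset hx)).deriv]
    have h1 := T₁.neg x hx'
    have h2 := T₂.neg x hx'
    have h3 := le_of_source_le hD hg₂ hg T₁ T₂ hx'
    have h4 : g₁ x / -Z₁ x ≤ (g₂ x + ε) / -Z₂ x := by
      have : 0 < g₁ x := (hg₂ x hx').trans_le (hg x hx')
      have hge := hε x hx'
      calc g₁ x / -Z₁ x ≤ g₁ x / -Z₂ x :=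
            div_le_div_of_nonneg_left this.le (by linarith) (by linarith)
        _ ≤ _ := div_le_div_of_nonneg_right hge (by linarith)
    have e : D x * (g₁ x / Z₁ x - g₂ x / Z₂ x) - ε * (D x / Z₂ x) =
        D x * ((g₂ x + ε) / -Z₂ x - g₁ x / -Z₁ x) := by
      rw [div_neg, div_neg]; ring
    rw [e]
    exact mul_nonneg (hD x hx').le (sub_nonneg.2 h4)
  have := hmono (left_mem_Icc.2 hρr) (right_mem_Icc.2 hρr) hρr
  simp only at this
  linarith

theorem continuousOn (hf : ContinuousOn f (Icc 0 ρbar))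
    (T : PhaseTrajectory ρbar f D g₁ c y₁ Z₁) : ContinuousOn Z₁ (Ioo 0 ρbar) := by
  have h1 : ContinuousOn (fun r => Z₁ r - f r + c * r) (Ioo 0 ρbar) := fun x hx =>
    (T.hasDerivAt x hx).continuousAt.continuousWithinAt
  refine ((h1.add (hf.mono Ioo_subset_Icc_self)).sub
    (continuousOn_const.mul continuousOn_id)).congr (f := fun r => _ + f r - c * r) fun x _ => ?_
  ring

/-- Convergence in the phase plane. -/
theorem tendstoUniformlyOn {g₀ : ℝ → ℝ} {g : ℕ → ℝ → ℝ} {y₀ Z₀ : ℝ → ℝ} {y Z : ℕ → ℝ → ℝ}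
    (H : Coefficients ρbar f D g₀)
    (hg : ∀ n, ∀ ρ ∈ Ioo 0 ρbar, g₀ ρ ≤ g n ρ) (hg_le : ∀ n, ∀ ρ ∈ Ioo 0 ρbar, g n ρ ≤ g 0 ρ)
    (hlim : TendstoUniformlyOn g g₀ atTop (Ioo 0 ρbar))
    (T₀ : PhaseTrajectory ρbar f D g₀ c y₀ Z₀)
    (T : ∀ n, PhaseTrajectory ρbar f D (g n) c (y n) (Z n))
    {a b : ℝ} (ha : 0 < a) (hab : a ≤ b) (hb : b < ρbar) :
    TendstoUniformlyOn Z Z₀ atTop (Icc a b) := by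
  rw [Metric.tendstoUniformlyOn_iff] at hlim ⊢
  intro ε hε
  -- `Z 0` is the first trajectory of the sequence, not the limit `Z₀`. By comparison `Z 0 r ≤ Z n r
  -- < 0` for all `n`, so one `r` serves the whole sequence.
  have h1 : ∀ᶠ r in 𝓝[<] ρbar, -(ε / 2) < Z 0 r :=
    (T 0).tendsto.eventually_const_lt (by linarith)
  obtain ⟨r, hr1, hr2⟩ := (h1.and (Ioo_mem_nhdsLT hb)).exists
  have hsub : ∀ x ∈ Icc a r, x ∈ Ioo 0 ρbar := fun x hx =>
    ⟨ha.trans_le hx.1, hx.2.trans_lt hr2.2⟩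
  have hyc : ContinuousOn y₀ (Icc a r) := fun x hx =>
    (T₀.hasDerivAt_inverse x (hsub x hx)).continuousAt.continuousWithinAt
  obtain ⟨M, hM⟩ := isCompact_Icc.exists_bound_of_continuousOn hyc
  have har : a ≤ r := hab.trans hr2.1.le
  have hM0 : 0 ≤ M := (norm_nonneg _).trans (hM a (left_mem_Icc.2 har))
  set δ := ε / (4 * (M + 1)) with hδ
  have hδpos : 0 < δ := by positivity
  filter_upwards [hlim δ hδpos] with n hn ρ hρ
  have hρI : ρ ∈ Icc a r := ⟨hρ.1, hρ.2.trans hr2.1.le⟩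
  have hrI : r ∈ Icc a r := right_mem_Icc.2 har
  have key := sub_le_of_source_le (ε := δ) H.diff_pos H.source_pos (hg n) (fun x hx => by
    have := hn x hx
    rw [Real.dist_eq, abs_lt] at this
    linarith [this.1]) (T n) T₀ (hsub ρ hρI).1 hρI.2 hr2.2
  have hle := le_of_source_le H.diff_pos H.source_pos (hg n) (T n) T₀ (hsub ρ hρI)
  have hle2 := le_of_source_le H.diff_pos (fun x hx => (H.source_pos x hx).trans_le (hg n x hx)) (hg_le n) (T 0)
    (T n) (hsub r hrI)
  have h0 := T₀.neg r (hsub r hrI)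
  have hy : y₀ ρ - y₀ r ≤ 2 * M := by
    have h1 := (abs_le.1 (hM ρ hρI)).2
    have h2 := (abs_le.1 (hM r hrI)).1
    linarith
  have hδM : δ * (y₀ ρ - y₀ r) < ε / 2 := by
    calc δ * (y₀ ρ - y₀ r) ≤ δ * (2 * M) := by gcongr
      _ < δ * (2 * (M + 1)) := by gcongr; linarith
      _ = ε / 2 := by rw [hδ]; field_simp; ring
  rw [Real.dist_eq, abs_of_nonneg (by linarith)]
  linarith

/-- Convergence of the inverse profiles. -/
theorem tendsto_inverse {g₀ : ℝ → ℝ} {g : ℕ → ℝ → ℝ} {y₀ Z₀ : ℝ → ℝ} {y Z : ℕ → ℝ → ℝ}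
    (H : Coefficients ρbar f D g₀)
    (hg : ∀ n, ∀ ρ ∈ Ioo 0 ρbar, g₀ ρ ≤ g n ρ) (hg_le : ∀ n, ∀ ρ ∈ Ioo 0 ρbar, g n ρ ≤ g 0 ρ)
    (hlim : TendstoUniformlyOn g g₀ atTop (Ioo 0 ρbar))
    (T₀ : PhaseTrajectory ρbar f D g₀ c y₀ Z₀)
    (T : ∀ n, PhaseTrajectory ρbar f D (g n) c (y n) (Z n))
    {p : ℝ} (hyp : ∀ n, y n p = y₀ p)
    {a b : ℝ} (hap : a ≤ p) (hpb : p ≤ b) (ha : 0 < a) (hb : b < ρbar) :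
    TendstoUniformlyOn y y₀ atTop (Icc a b) := by
  have hZ := tendstoUniformlyOn H hg hg_le hlim T₀ T ha (hap.trans hpb) hb
  have hsub : ∀ x ∈ Icc a b, x ∈ Ioo 0 ρbar := fun x hx =>
    ⟨ha.trans_le hx.1, hx.2.trans_lt hb⟩
  -- Since `|Z₀| ≤ |Z n|`, this function bounds the factor of `Z₀ - Z n` in `D/Z n - D/Z₀`,
  -- uniformly in `n`.
  have hc : ContinuousOn (fun x => D x / (Z₀ x * Z₀ x)) (Icc a b) := by
    have hZc := (T₀.continuousOn H.flux.continuousOn).mono hsub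
    refine (H.diff.mono fun x hx => Ioo_subset_Icc_self (hsub x hx)).div (hZc.mul hZc) fun x hx => ?_
    exact mul_ne_zero (T₀.neg x (hsub x hx)).ne (T₀.neg x (hsub x hx)).ne
  obtain ⟨M, hM⟩ := isCompact_Icc.exists_bound_of_continuousOn hc
  have hM0 : 0 ≤ M := (norm_nonneg _).trans (hM p ⟨hap, hpb⟩)
  rw [Metric.tendstoUniformlyOn_iff] at hZ ⊢
  intro ε hε
  set δ := ε / (M * (b - a) + 1) with hδ
  have hba : 0 ≤ b - a := by linarith
  have hδpos : 0 < δ := by positivity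
  filter_upwards [hZ δ hδpos] with n hn ρ hρ
  have hd : ∀ x ∈ Icc a b, HasDerivWithinAt (fun x => y n x - y₀ x)
      (D x / Z n x - D x / Z₀ x) (Icc a b) x := fun x hx =>
    (((T n).hasDerivAt_inverse x (hsub x hx)).fun_sub
      (T₀.hasDerivAt_inverse x (hsub x hx))).hasDerivWithinAt
  have hbound : ∀ x ∈ Icc a b, ‖D x / Z n x - D x / Z₀ x‖ ≤ M * δ := by
    intro x hx
    have hx' := hsub x hx
    have h1 := T₀.neg x hx'
    have h2 := (T n).neg x hx'
    have h3 := le_of_source_le H.diff_pos H.source_pos (hg n) (T n) T₀ hx'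
    have h4 := hn x hx
    have h5 := H.diff_pos x hx'
    rw [Real.dist_eq, abs_of_nonneg (by linarith)] at h4
    have h6 := hM x hx
    have h7 : 0 < Z₀ x * Z₀ x := mul_pos_of_neg_of_neg h1 h1
    have h8 : Z₀ x * Z₀ x ≤ Z n x * Z₀ x := mul_le_mul_of_nonpos_right h3 h1.le
    rw [Real.norm_of_nonneg (by positivity)] at h6
    have e : D x / Z n x - D x / Z₀ x = D x / (Z n x * Z₀ x) * (Z₀ x - Z n x) := by
      field_simp [h1.ne, h2.ne]
    have h9 : 0 ≤ D x / (Z n x * Z₀ x) := div_nonneg h5.le (h7.le.trans h8)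
    have h10 : D x / (Z n x * Z₀ x) ≤ M :=
      (div_le_div_of_nonneg_left h5.le h7 h8).trans h6
    rw [e, Real.norm_of_nonneg (mul_nonneg h9 (by linarith))]
    exact mul_le_mul h10 h4.le (by linarith) hM0
  have key := (convex_Icc a b).norm_image_sub_le_of_norm_hasDerivWithin_le hd hbound ⟨hap, hpb⟩ hρ
  simp only [hyp n, sub_self, sub_zero] at key
  rw [dist_comm, Real.dist_eq]
  refine key.trans_lt ?_
  have hρp : ‖ρ - p‖ ≤ b - a := by
    rw [Real.norm_eq_abs, abs_le]; constructor <;> linarith [hρ.1, hρ.2]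
  calc M * δ * ‖ρ - p‖ ≤ M * δ * (b - a) := by gcongr
    _ < (M * (b - a) + 1) * δ := by nlinarith
    _ = ε := by rw [hδ]; field_simp

end PhaseTrajectory

end SemiWave

/-! ### The convergence theorem -/

/-- Convergence of semi-wavefront profiles to a wavefront profile (the sequence of the source terms
is indexed by `ℕ`). -/
theorem mainTheorem4
    (ρbar : ℝ) (hρbar : 0 < ρbar)
    (f D g₀ : ℝ → ℝ) (g : ℕ → ℝ → ℝ)
    (hf : ContDiffOn ℝ 1 f (Icc 0 ρbar)) (hf0 : f 0 = 0)
    (hD : SemiWave.CondDhat ρbar D ∨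
      (SemiWave.CondDtilde ρbar D g₀ ∧ ∀ n, SemiWave.CondDtilde ρbar D (g n)))
    (hg₀ : SemiWave.CondG₀ ρbar D g₀)
    (hg : ∀ n, SemiWave.CondG ρbar (g n))
    (hg_decreasing : ∀ n, ∀ ρ ∈ Icc 0 ρbar, g (n + 1) ρ ≤ g n ρ)
    (hg_tendsto : TendstoUniformlyOn g g₀ atTop (Icc 0 ρbar))
    (c : ℝ) (hc : SemiWave.thresholdSpeed ρbar f D g₀ ≤ (c : EReal))
    (φ₀ : ℝ → ℝ) (hφ₀ : SemiWave.IsWavefront ρbar f D g₀ c ρbar 0 φ₀)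
    (hφ₀_zero : φ₀ 0 = ρbar / 2)
    (ϖ : ℕ → ℝ) (φ : ℕ → ℝ → ℝ)
    (hφ : ∀ n, SemiWave.IsMaximalSemiWavefrontFrom ρbar f D (g n) c ρbar (ϖ n) (φ n))
    (hϖ : ∀ n, 0 < ϖ n) (hφ_zero : ∀ n, φ n 0 = ρbar / 2)
    (J : Set ℝ) (hJ : SemiWave.IsMaximalOpenInterval ρbar φ₀ J) :
    SemiWave.TendstoC1Loc (fun n => Iio (ϖ n)) φ φ₀ J := by
  have hDcoef : ContinuousOn D (Icc 0 ρbar) ∧ ∀ ρ ∈ Ioo 0 ρbar, 0 < D ρ := by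
    rcases hD with h | h
    · exact ⟨h.contDiffOn.continuousOn, h.pos⟩
    · exact ⟨h.1.continuousOn, h.1.pos⟩
  have H₀ : SemiWave.Coefficients ρbar f D g₀ := by
    refine ⟨hρbar, hf, hDcoef.1, hDcoef.2, hg₀.continuousOn, fun ρ hρ => ?_, hg₀.pos⟩
    rcases hρ.1.eq_or_lt with rfl | h0
    · exact hg₀.eq_zero_left.ge
    · rcases hρ.2.eq_or_lt with rfl | h1
      · exact hg₀.eq_zero_right.ge
      · exact (hg₀.pos ρ ⟨h0, h1⟩).le
  have H : ∀ n, SemiWave.Coefficients ρbar f D (g n) := fun n => by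
    refine ⟨hρbar, hf, hDcoef.1, hDcoef.2, (hg n).continuousOn, fun ρ hρ => ?_,
      fun ρ hρ => (hg n).pos ρ ⟨hρ.1.le, hρ.2⟩⟩
    rcases hρ.2.eq_or_lt with rfl | h1
    · exact (hg n).eq_zero.ge
    · exact ((hg n).pos ρ ⟨hρ.1, h1⟩).le
  have hanti : ∀ ρ ∈ Ioo 0 ρbar, Antitone fun n => g n ρ := fun ρ hρ =>
    antitone_nat_of_succ_le fun n => hg_decreasing n ρ (Ioo_subset_Icc_self hρ)
  have hge : ∀ n, ∀ ρ ∈ Ioo 0 ρbar, g₀ ρ ≤ g n ρ := fun n ρ hρ =>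
    (hanti ρ hρ).le_of_tendsto (hg_tendsto.tendsto_at (Ioo_subset_Icc_self hρ)) n
  have hle : ∀ n, ∀ ρ ∈ Ioo 0 ρbar, g n ρ ≤ g 0 ρ := fun n ρ hρ => hanti ρ hρ n.zero_le
  have hlim : TendstoUniformlyOn g g₀ atTop (Ioo 0 ρbar) := hg_tendsto.mono Ioo_subset_Icc_self
  have hmid : ρbar / 2 ∈ Ioo 0 ρbar := ⟨by linarith, by linarith⟩
  obtain ⟨v₀, P₀, hsurj₀⟩ := hφ₀.exists_fluxProfile H₀
  obtain ⟨y₀, Z₀, T₀, hy₀, hφy₀⟩ := P₀.exists_phaseTrajectory H₀ hsurj₀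
  choose v P hsurj using fun n => (hφ n).exists_fluxProfile (H n) (hϖ n)
    (by rw [hφ_zero n]; exact hmid.2)
  choose y Z T hy hφy using fun n => (P n).exists_phaseTrajectory (H n) (hsurj n)
  have hy_mid : ∀ n, y n (ρbar / 2) = y₀ (ρbar / 2) := fun n => by
    have h1 := (hφy n 0 (hϖ n) (by rwa [hφ_zero n])).1
    have h2 := (hφy₀ 0 (mem_univ _) (by rwa [hφ₀_zero])).1
    rw [hφ_zero n] at h1
    rw [hφ₀_zero] at h2
    rw [h1, h2]
  have hJsub : J ⊆ univ ∩ φ₀ ⁻¹' Ioo 0 ρbar := fun x hx => ⟨mem_univ x, hJ.prop.2.2 x hx⟩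
  refine ⟨(P₀.contDiffOn H₀).mono hJsub, fun K hK hKJ => ?_⟩
  -- The point `0` is adjoined to `K` so that the anchoring density `ρbar / 2` lies in the range of
  -- densities considered.
  obtain ⟨α, β, hα, hβ, hα0, hβ0, hKαβ⟩ : ∃ α β, φ₀ α < ρbar ∧ 0 < φ₀ β ∧ α ≤ 0 ∧ 0 ≤ β ∧
      K ⊆ Icc α β := by
    have K'c : IsCompact (insert 0 K) := hK.insert 0
    have hne : (insert 0 K).Nonempty := insert_nonempty 0 K
    have hin : ∀ x ∈ insert 0 K, φ₀ x ∈ Ioo 0 ρbar := by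
      rintro x (rfl | hx)
      · rwa [hφ₀_zero]
      · exact (hJsub (hKJ hx)).2
    exact ⟨sInf (insert 0 K), sSup (insert 0 K), (hin _ (K'c.sInf_mem hne)).2,
      (hin _ (K'c.sSup_mem hne)).1, csInf_le K'c.bddBelow (mem_insert 0 K),
      le_csSup K'c.bddAbove (mem_insert 0 K), fun x hx =>
      ⟨csInf_le K'c.bddBelow (mem_insert_of_mem 0 hx),
        le_csSup K'c.bddAbove (mem_insert_of_mem 0 hx)⟩⟩
  have A₀ := P₀.antitoneOn H₀
  have hα' : ρbar / 2 ≤ φ₀ α := hφ₀_zero ▸ A₀ (mem_univ α) (mem_univ 0) hα0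
  have hβ' : φ₀ β ≤ ρbar / 2 := hφ₀_zero ▸ A₀ (mem_univ 0) (mem_univ β) hβ0
  obtain ⟨a, ha0, haβ⟩ := exists_between hβ
  obtain ⟨b, hαb, hb⟩ := exists_between hα
  have haI : a ∈ Ioo 0 ρbar := ⟨ha0, by linarith⟩
  have hbI : b ∈ Ioo 0 ρbar := ⟨by linarith, hb⟩
  have hab : a ≤ b := by linarith
  have hsub : ∀ ρ ∈ Icc a b, ρ ∈ Ioo 0 ρbar := fun ρ hρ =>
    ⟨ha0.trans_le hρ.1, hρ.2.trans_lt hb⟩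
  have hZ := SemiWave.PhaseTrajectory.tendstoUniformlyOn H₀ hge hle hlim T₀ T ha0 hab hb
  have hyu := SemiWave.PhaseTrajectory.tendsto_inverse H₀ hge hle hlim T₀ T hy_mid
    (haβ.le.trans hβ') (hα'.trans hαb.le) ha0 hb
  have hya : β < y₀ a := by
    by_contra! h
    have := A₀ (mem_univ _) (mem_univ _) h
    rw [(hy₀ a haI).2] at this
    linarith
  have hyb : y₀ b < α := by
    by_contra! h
    have := A₀ (mem_univ _) (mem_univ _) h
    rw [(hy₀ b hbI).2] at this
    linarith
  -- `a` and `b` were taken strictly outside the values of `φ₀` on `[α, β]`, so `y₀ b < α` and `β <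
  -- y₀ a` persist for `y n`. As `y n a < ϖ n`, the profile `φ n` is defined on `[α, β]`.
  have hrange : ∀ᶠ n in atTop, ∀ x ∈ Icc α β, x ∈ Iio (ϖ n) ∧ φ n x ∈ Icc a b := by
    filter_upwards [(hyu.tendsto_at (left_mem_Icc.2 hab)).eventually_const_lt hya,
      (hyu.tendsto_at (right_mem_Icc.2 hab)).eventually_lt_const hyb] with n h1 h2 x hx
    obtain ⟨h3, h4⟩ := hy n a haI
    obtain ⟨h5, h6⟩ := hy n b hbI
    have hxI : x ∈ Iio (ϖ n) := (hx.2.trans h1.le).trans_lt h3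
    refine ⟨hxI, ?_, ?_⟩
    · rw [← h4]; exact (P n).antitoneOn (H n) hxI h3 (hx.2.trans h1.le)
    · rw [← h6]; exact (P n).antitoneOn (H n) h5 hxI (h2.le.trans hx.1)
  have hrange₀ : ∀ x ∈ Icc α β, φ₀ x ∈ Icc a b := fun x hx =>
    ⟨haβ.le.trans (A₀ (mem_univ _) (mem_univ _) hx.2),
      (A₀ (mem_univ _) (mem_univ _) hx.1).trans hαb.le⟩
  -- With `ρ = φ n x`, the points `x = y n ρ` and `y₀ ρ` are close, and `φ₀ (y₀ ρ) = ρ`; uniform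
  -- continuity of `φ₀` concludes.
  have hφu : TendstoUniformlyOn φ φ₀ atTop (Icc α β) := by
    have huc := (isCompact_Icc (a := y₀ b) (b := y₀ a)).uniformContinuousOn_of_continuous
      (P₀.continuousOn.mono (subset_univ _))
    rw [Metric.uniformContinuousOn_iff] at huc
    rw [Metric.tendstoUniformlyOn_iff] at hyu ⊢
    intro ε hε
    obtain ⟨δ, hδ, hδε⟩ := huc ε hε
    filter_upwards [hrange, hyu δ hδ] with n h1 h2 x hx
    obtain ⟨hxI, hρ⟩ := h1 x hx
    have h3 := h2 _ hρ
    rw [(hφy n x hxI (hsub _ hρ)).1, dist_comm] at h3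
    have h4 := (hy₀ _ (hsub _ hρ)).2
    have h5 : y₀ (φ n x) ∈ Icc (y₀ b) (y₀ a) := by
      constructor
      · by_contra! h
        have := P₀.strictAntiOn H₀ ⟨mem_univ _, by rw [mem_preimage, h4]; exact hsub _ hρ⟩
          ⟨mem_univ _, by rw [mem_preimage, (hy₀ b hbI).2]; exact hbI⟩ h
        rw [h4, (hy₀ b hbI).2] at this
        exact absurd hρ.2 (not_le.2 this)
      · by_contra! h
        have := P₀.strictAntiOn H₀ ⟨mem_univ _, by rw [mem_preimage, (hy₀ a haI).2]; exact haI⟩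
          ⟨mem_univ _, by rw [mem_preimage, h4]; exact hsub _ hρ⟩ h
        rw [h4, (hy₀ a haI).2] at this
        exact absurd hρ.1 (not_le.2 this)
    have := hδε x ⟨hyb.le.trans hx.1, hx.2.trans hya.le⟩ _ h5 h3
    rwa [h4] at this
  have hdu : TendstoUniformlyOn (fun n => deriv (φ n)) (deriv φ₀) atTop (Icc α β) := by
    have hDc : ContinuousOn D (Icc a b) := hDcoef.1.mono fun x hx => Ioo_subset_Icc_self (hsub x hx)
    have hDne : ∀ x ∈ Icc a b, D x ≠ 0 := fun x hx => (hDcoef.2 x (hsub x hx)).ne'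
    have huc := isCompact_Icc.uniformContinuousOn_of_continuous
      (((T₀.continuousOn hf.continuousOn).mono hsub).div hDc hDne)
    rw [Metric.uniformContinuousOn_iff] at huc
    obtain ⟨M, hM⟩ := isCompact_Icc.exists_bound_of_continuousOn (hDc.inv₀ hDne)
    have hM0 : 0 ≤ M := (norm_nonneg _).trans (hM a (left_mem_Icc.2 hab))
    rw [Metric.tendstoUniformlyOn_iff] at hZ hφu ⊢
    intro ε hε
    obtain ⟨δ, hδ, hδε⟩ := huc (ε / 2) (half_pos hε)
    filter_upwards [hrange, hφu δ hδ, hZ (ε / (2 * (M + 1))) (by positivity)] with n h1 h2 h3 x hx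
    obtain ⟨hxI, hρ⟩ := h1 x hx
    rw [(hφy n x hxI (hsub _ hρ)).2, (hφy₀ x (mem_univ x) (hsub _ (hrange₀ x hx))).2]
    have h4 := hδε _ (hrange₀ x hx) _ hρ (h2 x hx)
    -- First the density is changed in the fixed function `Z₀ / D`, then the trajectory at a fixed
    -- density.
    refine (dist_triangle _ (Z₀ (φ n x) / D (φ n x)) _).trans_lt ?_
    have h5 : dist (Z₀ (φ n x) / D (φ n x)) (Z n (φ n x) / D (φ n x)) < ε / 2 := by
      have h6 := h3 _ hρ
      have h7 := hM _ hρ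
      rw [Real.dist_eq] at h6 ⊢
      rw [← sub_div, div_eq_mul_inv, abs_mul]
      calc |Z₀ (φ n x) - Z n (φ n x)| * |(D (φ n x))⁻¹| ≤ ε / (2 * (M + 1)) * M :=
            mul_le_mul h6.le h7 (abs_nonneg _) (by positivity)
        _ < ε / (2 * (M + 1)) * (M + 1) := by gcongr; linarith
        _ = ε / 2 := by field_simp
    simp only [Pi.div_apply] at h4
    linarith
  refine ⟨?_, hφu.mono hKαβ, hdu.mono hKαβ⟩
  filter_upwards [hrange] with n hn
  exact ⟨Iio (ϖ n) ∩ φ n ⁻¹' Ioo 0 ρbar, (P n).isOpen_active,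
    fun x hx => ⟨(hn x (hKαβ hx)).1, hsub _ (hn x (hKαβ hx)).2⟩, inter_subset_left,
    (P n).contDiffOn (H n)⟩
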